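/- For $a\in\mathbb R$, $b>0$ let $L_{a,b}\subset\mathbb R^2$ be the lattice generated by $(1/\sqrt b,\,0)$ and $(a/\sqrt b,\,\sqrt b)$, and let $T_{a,b}=\mathbb R^2/L_{a,b}$ be the corresponding unit-volume flat torus, with its geodesic distance $d$ and its area measure. The unit-volume flat tori are parametrized (by a standard fact, recalled only as background, up to isometry) as the $T_{a,b}$ with $(a,b)\in U$, where $$U=\{(a,b)\in\mathbb R^2:\ b>0,\ 0\le a\le \tfrac12,\ a^2+b^2\ge 1\};$$ the square torus is $(a,b)=(0,1)$ and the equilateral torus is $(a,b)=(\tfrac12,\tfrac{\sqrt3}{2})$. Let $f$ be a real function which is positive and non-increasing on $(0,\infty)$, and suppose that $$\int_{T_{a,b}}\int_{T_{a,b}}|f(d^2(x,y))|^2\,dx\,dy<\infty$$ for some $(a,b)\in U$. Then this holds for all $a\in\mathbb R$, $b>0$, so that $$A_f\psi(x)=\int_{T_{a,b}}f(d^2(x,y))\,\psi(y)\,dy$$ is a Hilbert–Schmidt operator on $L^2(T_{a,b})$ (with real or with complex scalars). Let $N(a,b)$ denote either its operator norm $\|A_f\|_{L^2(T_{a,b})\to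 L^2(T_{a,b})}$ or its Hilbert–Schmidt norm $\|A_f\|_{\mathrm{H.S.}}$. For each of these two choices of $N$: 1. $N(a,b)\le N(\tfrac12,\tfrac{\sqrt3}{2})$ for all $(a,b)\in U$, i.e. the equilateral torus is a maximizer among the unit-volume flat tori $T_{a,b}$, $(a,b)\in U$; 2. the square torus is a critical point: as a function on the half-plane $\{b>0\}$, $N$ is differentiable at $(0,1)$ and its derivative there is zero; 3. if $f$ is strictly decreasing on $(0,\infty)$, then $N(a,b)<N(\tfrac12,\tfrac{\sqrt3}{2})$ for all $(a,b)\in U$ other than $(\tfrac12,\tfrac{\sqrt3}{2})$, i.e. the equilateral torus is the unique maximizer, and the square torus is a saddle point of $N$: a critical point which is neither a local maximum nor a local minimum of $N$ (not even of the restriction of $N$ to $U$). -/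

import Mathlib

open MeasureTheory Set Filter Topology
open scoped ENNReal

noncomputable section

namespace FlatTori

/-! ### Integral operators with square-integrable kernel -/

section IntegralOperator

variable {𝕜 X : Type*} [RCLike 𝕜] [MeasurableSpace X] {μ : Measure X} [SFinite μ]

theorem ae_memLp_section {k : X → X → 𝕜}
    (hk : MemLp (fun p : X × X => k p.1 p.2) 2 (μ.prod μ)) :
    ∀ᵐ x ∂μ, MemLp (k x) 2 μ := by
  have h1 := hk.1.prodMk_left
  have h2 : ∫⁻ x, ∫⁻ y, ‖k x y‖ₑ ^ (2 : ℝ) ∂μ ∂μ < ∞ := by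
    have h := lintegral_rpow_enorm_lt_top_of_eLpNorm_lt_top (by norm_num) (by norm_num) hk.2
    rw [lintegral_prod _ (hk.1.enorm.pow_const _)] at h
    simpa using h
  have h3 : AEMeasurable (fun x => ∫⁻ y, ‖k x y‖ₑ ^ (2 : ℝ) ∂μ) μ :=
    (hk.1.enorm.pow_const _).lintegral_prod_right'
  filter_upwards [h1, ae_lt_top' h3 h2.ne] with x hx1 hx2
  refine ⟨hx1, ?_⟩
  rw [eLpNorm_lt_top_iff_lintegral_rpow_enorm_lt_top (by norm_num) (by norm_num)]
  simpa using hx2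

theorem integrable_section {k : X → X → 𝕜}
    (hk : MemLp (fun p : X × X => k p.1 p.2) 2 (μ.prod μ)) {ψ : X → 𝕜} (hψ : MemLp ψ 2 μ) :
    ∀ᵐ x ∂μ, Integrable (fun y => k x y * ψ y) μ := by
  filter_upwards [ae_memLp_section hk] with x hx
  exact hx.integrable_mul hψ

theorem eLpNorm_integral_le {k : X → X → 𝕜}
    (hk : MemLp (fun p : X × X => k p.1 p.2) 2 (μ.prod μ)) {ψ : X → 𝕜} (hψ : MemLp ψ 2 μ) :
    eLpNorm (fun x => ∫ y, k x y * ψ y ∂μ) 2 μ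
      ≤ eLpNorm (fun p : X × X => k p.1 p.2) 2 (μ.prod μ) * eLpNorm ψ 2 μ := by
  have hpt : ∀ᵐ x ∂μ, ‖∫ y, k x y * ψ y ∂μ‖ₑ ^ (2 : ℝ)
      ≤ (∫⁻ y, ‖k x y‖ₑ ^ (2 : ℝ) ∂μ) * ∫⁻ y, ‖ψ y‖ₑ ^ (2 : ℝ) ∂μ := by
    filter_upwards [ae_memLp_section hk] with x hx
    have h1 : ‖∫ y, k x y * ψ y ∂μ‖ₑ ≤ ∫⁻ y, ‖k x y‖ₑ * ‖ψ y‖ₑ ∂μ := by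
      refine (enorm_integral_le_lintegral_enorm _).trans (le_of_eq ?_)
      simp only [enorm_mul]
    have h2 := ENNReal.lintegral_mul_le_Lp_mul_Lq μ Real.HolderConjugate.two_two
      hx.1.enorm hψ.1.enorm
    calc ‖∫ y, k x y * ψ y ∂μ‖ₑ ^ (2 : ℝ)
        ≤ ((∫⁻ y, ‖k x y‖ₑ ^ (2 : ℝ) ∂μ) ^ (1 / (2 : ℝ))
            * (∫⁻ y, ‖ψ y‖ₑ ^ (2 : ℝ) ∂μ) ^ (1 / (2 : ℝ))) ^ (2 : ℝ) := by
          gcongr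
          exact h1.trans h2
      _ = _ := by
          rw [ENNReal.mul_rpow_of_nonneg _ _ (by norm_num), ← ENNReal.rpow_mul,
            ← ENNReal.rpow_mul]
          norm_num
  have h3 : AEMeasurable (fun x => ∫⁻ y, ‖k x y‖ₑ ^ (2 : ℝ) ∂μ) μ :=
    (hk.1.enorm.pow_const _).lintegral_prod_right'
  rw [eLpNorm_eq_lintegral_rpow_enorm_toReal (by norm_num) (by norm_num),
    eLpNorm_eq_lintegral_rpow_enorm_toReal (by norm_num) (by norm_num),
    eLpNorm_eq_lintegral_rpow_enorm_toReal (by norm_num) (by norm_num),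
    ← ENNReal.mul_rpow_of_nonneg _ _ (by norm_num)]
  simp only [ENNReal.toReal_ofNat]
  gcongr
  rw [lintegral_prod _ (hk.1.enorm.pow_const _), ← lintegral_mul_const'' _ h3]
  exact lintegral_mono_ae hpt

theorem memLp_integral {k : X → X → 𝕜}
    (hk : MemLp (fun p : X × X => k p.1 p.2) 2 (μ.prod μ)) {ψ : X → 𝕜} (hψ : MemLp ψ 2 μ) :
    MemLp (fun x => ∫ y, k x y * ψ y ∂μ) 2 μ := by
  refine ⟨?_, (eLpNorm_integral_le hk hψ).trans_lt (ENNReal.mul_lt_top hk.2 hψ.2)⟩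
  exact (hk.1.mul hψ.1.comp_snd).integral_prod_right'

/-- The integral operator `(A ψ)(x) = ∫ k(x, y) ψ(y) dμ(y)` on `L²(μ)` with kernel
`k ∈ L²(μ × μ)`, as a bounded operator. -/
def integralOperator (k : X → X → 𝕜)
    (hk : MemLp (fun p : X × X => k p.1 p.2) 2 (μ.prod μ)) : Lp 𝕜 2 μ →L[𝕜] Lp 𝕜 2 μ :=
  LinearMap.mkContinuous
    { toFun := fun ψ => (memLp_integral hk (Lp.memLp ψ)).toLp (fun x => ∫ y, k x y * ψ y ∂μ)
      map_add' := by
        intro φ ψ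
        rw [← MemLp.toLp_add]
        refine MemLp.toLp_congr _ _ ?_
        filter_upwards [integrable_section hk (Lp.memLp φ),
          integrable_section hk (Lp.memLp ψ)] with x h1 h2
        simp only [Pi.add_apply]
        rw [← integral_add h1 h2]
        refine integral_congr_ae ?_
        filter_upwards [Lp.coeFn_add φ ψ] with y hy
        rw [hy, Pi.add_apply, mul_add]
      map_smul' := by
        intro c ψ
        rw [RingHom.id_apply, ← MemLp.toLp_const_smul]
        refine MemLp.toLp_congr _ _ (Eventually.of_forall fun x => ?_)
        simp only [Pi.smul_apply, smul_eq_mul]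
        rw [← integral_const_mul]
        refine integral_congr_ae ?_
        filter_upwards [Lp.coeFn_smul c ψ] with y hy
        rw [hy, Pi.smul_apply, smul_eq_mul, mul_left_comm] }
    (eLpNorm (fun p : X × X => k p.1 p.2) 2 (μ.prod μ)).toReal
    (by
      intro ψ
      simp only [LinearMap.coe_mk, AddHom.coe_mk]
      rw [Lp.norm_toLp, Lp.norm_def, ← ENNReal.toReal_mul]
      exact ENNReal.toReal_mono (ENNReal.mul_lt_top hk.2 (Lp.memLp ψ).2).ne
        (eLpNorm_integral_le hk (Lp.memLp ψ)))

/-- The defining formula of the integral operator. -/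
theorem integralOperator_ae_eq (k : X → X → 𝕜)
    (hk : MemLp (fun p : X × X => k p.1 p.2) 2 (μ.prod μ)) (ψ : Lp 𝕜 2 μ) :
    integralOperator k hk ψ =ᵐ[μ] fun x => ∫ y, k x y * ψ y ∂μ :=
  (memLp_integral hk (Lp.memLp ψ)).coeFn_toLp

end IntegralOperator

/-! ### The Hilbert-Schmidt norm -/

section HilbertSchmidt

variable {𝕜 H : Type*} [RCLike 𝕜] [NormedAddCommGroup H] [InnerProductSpace 𝕜 H]
  [CompleteSpace H]

/-- The Hilbert-Schmidt norm `(∑ᵢ ‖A eᵢ‖²)^(1/2) ∈ [0, ∞]` of a bounded operator, where `(eᵢ)` is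
an orthonormal basis (the value does not depend on the basis, see `ehsNorm_eq`). -/
def ehsNorm (A : H →L[𝕜] H) : ℝ≥0∞ :=
  (∑' i, ‖A ((exists_hilbertBasis 𝕜 H).choose_spec.choose i)‖ₑ ^ 2) ^ (1 / 2 : ℝ)

/-- The Hilbert-Schmidt norm as a real number, meaningful when `ehsNorm A ≠ ∞`. -/
def hsNorm (A : H →L[𝕜] H) : ℝ := (ehsNorm A).toReal

theorem tsum_inner_sq {ι : Type*} (b : HilbertBasis ι 𝕜 H) (x : H) :
    ∑' i, ‖inner 𝕜 (b i) x‖ₑ ^ 2 = ‖x‖ₑ ^ 2 := by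
  have h := b.hasSum_inner_mul_inner x x
  have h1 : ∀ i, inner 𝕜 x (b i) * inner 𝕜 (b i) x = ((‖inner 𝕜 (b i) x‖ ^ 2 : ℝ) : 𝕜) := by
    intro i
    rw [← inner_conj_symm x (b i), RCLike.conj_mul]
    push_cast
    rfl
  simp only [h1] at h
  rw [inner_self_eq_norm_sq_to_K] at h
  have h2 : HasSum (fun i => ‖inner 𝕜 (b i) x‖ ^ 2) (‖x‖ ^ 2) := by
    rw [← RCLike.hasSum_ofReal 𝕜]
    push_cast at h ⊢
    exact h
  have h3 : ∀ y : ℝ, 0 ≤ y → ENNReal.ofReal (y ^ 2) = ENNReal.ofReal y ^ 2 :=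
    fun y hy => ENNReal.ofReal_pow hy 2
  have h4 := ENNReal.ofReal_tsum_of_nonneg (fun i => sq_nonneg ‖inner 𝕜 (b i) x‖) h2.summable
  rw [h2.tsum_eq, h3 _ (norm_nonneg _), ofReal_norm] at h4
  rw [h4]
  refine tsum_congr fun i => ?_
  rw [h3 _ (norm_nonneg _), ofReal_norm]

theorem tsum_sq_eq_adjoint {ι κ : Type*} (b : HilbertBasis ι 𝕜 H) (c : HilbertBasis κ 𝕜 H)
    (A : H →L[𝕜] H) :
    ∑' i, ‖A (b i)‖ₑ ^ 2 = ∑' j, ‖ContinuousLinearMap.adjoint A (c j)‖ₑ ^ 2 := by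
  simp only [← tsum_inner_sq c (A _), ← tsum_inner_sq b (ContinuousLinearMap.adjoint A _)]
  rw [ENNReal.tsum_comm]
  refine tsum_congr fun j => tsum_congr fun i => ?_
  rw [ContinuousLinearMap.adjoint_inner_right, ← ofReal_norm, ← ofReal_norm, norm_inner_symm]

/-- The Hilbert-Schmidt norm can be computed in any orthonormal basis. -/
theorem ehsNorm_eq {ι : Type*} (b : HilbertBasis ι 𝕜 H) (A : H →L[𝕜] H) :
    ehsNorm A = (∑' i, ‖A (b i)‖ₑ ^ 2) ^ (1 / 2 : ℝ) := by
  rw [ehsNorm, tsum_sq_eq_adjoint _ b A, tsum_sq_eq_adjoint b b A]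

end HilbertSchmidt

/-! ### Flat tori -/

/-- The Euclidean plane. -/
abbrev Plane : Type := EuclideanSpace ℝ (Fin 2)

/-- The first basis vector `(1/√b, 0)`. -/
def basisFst (b : ℝ) : Plane := !₂[1 / √b, 0]

/-- The second basis vector `(a/√b, √b)`. -/
def basisSnd (a b : ℝ) : Plane := !₂[a / √b, √b]

/-- The lattice `L_{a,b}` of all integer combinations of `(1/√b, 0)` and `(a/√b, √b)`. -/
def lattice (a b : ℝ) : AddSubgroup Plane := AddSubgroup.closure {basisFst b, basisSnd a b}

/-- The flat torus `T_{a,b} = ℝ² / L_{a,b}`. As a quotient it carries the geodesic distance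
`d([x], [y]) = inf {‖x - y - v‖ : v ∈ L_{a,b}}`, which is `dist`, and the quotient `σ`-algebra. -/
abbrev FlatTorus (a b : ℝ) : Type := Plane ⧸ lattice a b

/-- The half-open parallelogram spanned by the two basis vectors. -/
def parallelogram (a b : ℝ) : Set Plane :=
  {x | ∃ s ∈ Ico (0 : ℝ) 1, ∃ t ∈ Ico (0 : ℝ) 1, x = s • basisFst b + t • basisSnd a b}

/-- The Riemannian area measure of `T_{a,b}`: the image of Lebesgue measure on the parallelogram. -/
def torusMeasure (a b : ℝ) : Measure (FlatTorus a b) :=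
  (volume.restrict (parallelogram a b)).map (QuotientAddGroup.mk : Plane → FlatTorus a b)

instance (a b : ℝ) : SFinite (torusMeasure a b) := by
  unfold torusMeasure
  infer_instance

/-- The kernel `f(d²(x, y))` on `T_{a,b}`. -/
def kernel (f : ℝ → ℝ) (a b : ℝ) (x y : FlatTorus a b) : ℝ := f (dist x y ^ 2)

/-- The condition `∫∫ |f(d²(x, y))|² dx dy < ∞` on `T_{a,b}`. -/
def SquareIntegrableKernel (f : ℝ → ℝ) (a b : ℝ) : Prop :=
  ∫⁻ x, ∫⁻ y, ‖kernel f a b x y‖ₑ ^ 2 ∂(torusMeasure a b) ∂(torusMeasure a b) < ∞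

open Classical in
/-- The operator `(A_f ψ)(x) = ∫ f(d²(x, y)) ψ(y) dy` on `L²(T_{a,b})`
(by convention `0` if the kernel is not in `L²(T_{a,b} × T_{a,b})`). -/
def torusOperator (𝕜 : Type*) [RCLike 𝕜] (f : ℝ → ℝ) (a b : ℝ) :
    Lp 𝕜 2 (torusMeasure a b) →L[𝕜] Lp 𝕜 2 (torusMeasure a b) :=
  if hk : MemLp (fun p : FlatTorus a b × FlatTorus a b => ((kernel f a b p.1 p.2 : ℝ) : 𝕜)) 2
      ((torusMeasure a b).prod (torusMeasure a b)) then
    integralOperator (fun x y => ((kernel f a b x y : ℝ) : 𝕜)) hk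
  else 0

/-- `‖A_f‖` on `L²(T_{a,b})` as a function of the parameters `(a, b)`. -/
def opNormFun (𝕜 : Type*) [RCLike 𝕜] (f : ℝ → ℝ) (p : ℝ × ℝ) : ℝ :=
  ‖torusOperator 𝕜 f p.1 p.2‖

/-- `‖A_f‖_{H.S.}` on `L²(T_{a,b})` as a function of the parameters `(a, b)`. -/
def hsNormFun (𝕜 : Type*) [RCLike 𝕜] (f : ℝ → ℝ) (p : ℝ × ℝ) : ℝ :=
  hsNorm (torusOperator 𝕜 f p.1 p.2)

/-- The parameter domain `U` of unit-volume flat tori. -/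
def parameterDomain : Set (ℝ × ℝ) :=
  {p | 0 < p.2 ∧ p.1 ∈ Icc (0 : ℝ) (1 / 2) ∧ 1 ≤ p.1 ^ 2 + p.2 ^ 2}

/-- The parameters `(1/2, √3/2)` of the equilateral torus. -/
def equilateral : ℝ × ℝ := (1 / 2, √3 / 2)

/-- The parameters `(0, 1)` of the square torus. -/
def square : ℝ × ℝ := (0, 1)

/-- A critical point of a function of the parameters `(a, b)`: the function is differentiable there
with vanishing derivative. -/
def IsCriticalPoint (N : ℝ × ℝ → ℝ) (p : ℝ × ℝ) : Prop :=
  HasFDerivAt N (0 : ℝ × ℝ →L[ℝ] ℝ) p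

/-- A saddle point among the tori with parameters in `U`: a critical point which is neither a
local maximum nor a local minimum, already when compared with points of `U` only. -/
def IsSaddlePoint (N : ℝ × ℝ → ℝ) (p : ℝ × ℝ) : Prop :=
  IsCriticalPoint N p ∧ ¬ IsLocalMaxOn N parameterDomain p ∧ ¬ IsLocalMinOn N parameterDomain p

end FlatTori

end

/-!
Both norms of `A_f` are integrals over a single ball-counting function. The kernel is invariant
under translations, so constant functions are eigenfunctions with eigenvalue `∫ f(d²(x, 0)) dx`,
and by Schur's test this is the operator norm (`opNormFun_eq`). Parseval's identity in each row
shows that the square of the Hilbert-Schmidt norm is the same integral for `f²` (`hsNormFun_eq`).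
On the Voronoi cell of the lattice `d(x, 0) = ‖x‖`, so everything reduces to `radialIntegral`, the
integral of `f(‖x‖²)` over that cell. By the layer-cake formula it is an average, over levels of
`f`, of `cellVolume r a b`, the area of the part of the Voronoi cell at distance less than `r`
from the origin.

Write `A = 1/b`, `B = (a² + b²)/b`, `C = ((1 - a)² + b²)/b` for the squared lengths of the
shortest lattice vectors of a reduced lattice, and `R² = ABC/4` for the squared circumradius of
the Delaunay triangle. For `r ≤ R` the segments that the six bisectors cut off the disc of radius
`r` are disjoint and bound the cell, so the area is `πr²` minus the sum of `segmentArea r` at `A`,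
`B`, `C` (`cellVolume_le₃`, `le_cellVolume₃`). The derivative of `segmentArea r` is `A ↦ -√(r²/A -
1/4)`, and squaring turns the monotonicity statements below into polynomial inequalities whose
defect is a positive multiple of `R² - r²`: the area increases with `a ∈ [0, 1/2]`
(`segmentArea_add_antitoneOn`), and for `a = 1/2` decreases in `b ≥ √3/2`
(`segmentArea_isosceles_strictMonoOn`). This joins any point of the parameter domain to the
equilateral torus, which has the smallest `R`; beyond that `R` its balls have area `1`, the
largest possible value.

At the square torus, the area lies between two explicit functions with vanishing derivative, since
the first-order changes of the sides `1/b` and `b` cancel and the third segment is of higher order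
(`hasFDerivAt_cellVolume`). A Lipschitz bound uniform in `r` (`abs_cellVolume_sub_square_le`)
allows differentiation under the layer-cake integral. Shearing the square lattice enlarges balls,
because the rectangular cell is a fundamental domain for the sheared lattices too
(`cellVolume_zero_le`), while elongating it shrinks them (`cellVolume_rectangular_le`); hence a
saddle point.
-/

noncomputable section

namespace FlatTori

/-! ### The lattice and its fundamental domains -/

theorem basisFst_zero (b : ℝ) : basisFst b 0 = 1 / √b := rfl
theorem basisFst_one (b : ℝ) : basisFst b 1 = 0 := rfl
theorem basisSnd_zero (a b : ℝ) : basisSnd a b 0 = a / √b := rfl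
theorem basisSnd_one (a b : ℝ) : basisSnd a b 1 = √b := rfl

theorem mem_lattice_iff {a b : ℝ} {v : Plane} :
    v ∈ lattice a b ↔ ∃ m n : ℤ, m • basisFst b + n • basisSnd a b = v :=
  AddSubgroup.mem_closure_pair

theorem zsmul_add_zsmul_zero (a b : ℝ) (m n : ℤ) :
    (m • basisFst b + n • basisSnd a b : Plane) 0 = (m + n * a) / √b := by
  simp [basisFst_zero, basisSnd_zero]
  ring

theorem zsmul_add_zsmul_one (a b : ℝ) (m n : ℤ) :
    (m • basisFst b + n • basisSnd a b : Plane) 1 = n * √b := by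
  simp [basisFst_one, basisSnd_one]

theorem norm_sq_eq_coords (x : Plane) : ‖x‖ ^ 2 = x 0 ^ 2 + x 1 ^ 2 := by
  rw [EuclideanSpace.norm_sq_eq]
  simp

theorem inner_eq_coords (x y : Plane) : inner ℝ x y = x 0 * y 0 + x 1 * y 1 := by
  simp [PiLp.inner_apply, mul_comm]

/-- A lower bound for the length of the nonzero vectors of `L_{a,b}`. -/
theorem exists_le_norm_of_mem_lattice (a : ℝ) {b : ℝ} (hb : 0 < b) :
    ∃ δ > 0, ∀ v ∈ lattice a b, v ≠ 0 → δ ≤ ‖v‖ := by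
  refine ⟨min √b (1 / √b), by positivity, fun v hv hv0 => ?_⟩
  obtain ⟨m, n, rfl⟩ := mem_lattice_iff.1 hv
  have hs : 0 < √b := Real.sqrt_pos.2 hb
  have hn := norm_sq_eq_coords (m • basisFst b + n • basisSnd a b : Plane)
  rw [zsmul_add_zsmul_zero, zsmul_add_zsmul_one] at hn
  by_cases h : n = 0
  · subst h
    have hm : m ≠ 0 := by
      rintro rfl
      simp at hv0
    have h1 : (1 : ℝ) ≤ (m : ℝ) ^ 2 := by
      have : 1 ≤ m ^ 2 := by
        have := sq_nonneg m
        have : m ^ 2 ≠ 0 := pow_ne_zero 2 hm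
        omega
      exact_mod_cast this
    refine (min_le_right _ _).trans (abs_le_of_sq_le_sq' ?_ (norm_nonneg _)).2
    rw [hn]
    simp only [Int.cast_zero, zero_mul, add_zero, div_pow, one_pow]
    have : 1 / √b ^ 2 ≤ m ^ 2 / √b ^ 2 := by gcongr
    linarith
  · have h1 : (1 : ℝ) ≤ (n : ℝ) ^ 2 := by
      have : 1 ≤ n ^ 2 := by
        have := sq_nonneg n
        have : n ^ 2 ≠ 0 := pow_ne_zero 2 h
        omega
      exact_mod_cast this
    refine (min_le_left _ _).trans (abs_le_of_sq_le_sq' ?_ (norm_nonneg _)).2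
    rw [hn]
    nlinarith [sq_nonneg ((m + n * a) / √b), sq_nonneg √b]

theorem isClosed_lattice (a : ℝ) {b : ℝ} (hb : 0 < b) : IsClosed (lattice a b : Set Plane) := by
  obtain ⟨δ, hδ, h⟩ := exists_le_norm_of_mem_lattice a hb
  refine Metric.isClosed_of_pairwise_le_dist hδ fun x hx y hy hxy => ?_
  change δ ≤ dist x y
  rw [dist_eq_norm]
  exact h _ (sub_mem hx hy) (sub_ne_zero.2 hxy)

instance countable_lattice (a b : ℝ) : Countable (lattice a b) := by
  have : (lattice a b : Set Plane) ⊆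
      range fun p : ℤ × ℤ => (p.1 • basisFst b + p.2 • basisSnd a b : Plane) := by
    intro v hv
    obtain ⟨m, n, rfl⟩ := mem_lattice_iff.1 hv
    exact ⟨(m, n), rfl⟩
  exact ((countable_range _).mono this).to_subtype

/-- A set which is, in suitable coordinates, a unit strip cut into unit intervals, with an arbitrary
measurable shear `θ` of the rows, is a fundamental domain of `L_{a,b}`. -/
theorem isAddFundamentalDomain_of_shear (a : ℝ) {b : ℝ} (hb : 0 < b) (s₀ t₀ : ℝ) {θ : ℝ → ℝ}
    (hθ : Measurable θ) :
    IsAddFundamentalDomain (lattice a b)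
      {x : Plane | x 1 / √b ∈ Ico t₀ (t₀ + 1) ∧ x 0 * √b - θ (x 1 / √b) ∈ Ico s₀ (s₀ + 1)} := by
  have hs : 0 < √b := Real.sqrt_pos.2 hb
  have hm0 : Measurable fun x : Plane => x 0 := by fun_prop
  have hm1 : Measurable fun x : Plane => x 1 := by fun_prop
  refine IsAddFundamentalDomain.mk' ?_ fun x => ?_
  · refine MeasurableSet.nullMeasurableSet (MeasurableSet.inter ?_ ?_)
    · exact measurableSet_Ico.preimage (hm1.div_const _)
    · exact measurableSet_Ico.preimage
        ((hm0.mul_const _).sub (hθ.comp (hm1.div_const _)))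
  have key : ∀ m n : ℤ, ((m • basisFst b + n • basisSnd a b) + x) 1 / √b = x 1 / √b + n ∧
      ((m • basisFst b + n • basisSnd a b) + x) 0 * √b = x 0 * √b + n * a + m := by
    intro m n
    have hadd : ∀ (v : Plane) (i : Fin 2), (v + x) i = v i + x i := fun _ _ => rfl
    rw [hadd, hadd, zsmul_add_zsmul_zero, zsmul_add_zsmul_one]
    constructor <;> field_simp <;> ring
  obtain ⟨n, hn, hn'⟩ := existsUnique_add_zsmul_mem_Ico (zero_lt_one' ℝ) (x 1 / √b) t₀
  obtain ⟨m, hm, hm'⟩ := existsUnique_add_zsmul_mem_Ico (zero_lt_one' ℝ)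
    (x 0 * √b + n * a - θ (x 1 / √b + n)) s₀
  simp only [zsmul_eq_mul, mul_one] at hn hn' hm hm'
  refine ⟨⟨m • basisFst b + n • basisSnd a b, mem_lattice_iff.2 ⟨m, n, rfl⟩⟩, ?_, ?_⟩
  · change ((m • basisFst b + n • basisSnd a b) + x) 1 / √b ∈ _ ∧
      ((m • basisFst b + n • basisSnd a b) + x) 0 * √b
        - θ (((m • basisFst b + n • basisSnd a b) + x) 1 / √b) ∈ _
    rw [(key m n).1, (key m n).2]
    exact ⟨hn, by convert hm using 1; ring⟩
  · rintro ⟨v, hv⟩ h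
    obtain ⟨m', n', rfl⟩ := mem_lattice_iff.1 hv
    change ((m' • basisFst b + n' • basisSnd a b) + x) 1 / √b ∈ _ ∧
      ((m' • basisFst b + n' • basisSnd a b) + x) 0 * √b
        - θ (((m' • basisFst b + n' • basisSnd a b) + x) 1 / √b) ∈ _ at h
    rw [(key m' n').1, (key m' n').2] at h
    obtain rfl := hn' n' h.1
    obtain rfl := hm' m' (by convert h.2 using 1; ring)
    rfl

theorem isAddFundamentalDomain_parallelogram (a : ℝ) {b : ℝ} (hb : 0 < b) :
    IsAddFundamentalDomain (lattice a b) (parallelogram a b) := by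
  have hs : 0 < √b := Real.sqrt_pos.2 hb
  convert isAddFundamentalDomain_of_shear a hb 0 0 (θ := fun t => t * a) (by fun_prop) using 1
  ext x
  simp only [zero_add, mem_ofPred_eq]
  constructor
  · rintro ⟨s, hs', t, ht, rfl⟩
    simp only [PiLp.add_apply, PiLp.smul_apply, basisFst_zero, basisFst_one, basisSnd_zero,
      basisSnd_one, smul_eq_mul]
    constructor
    · convert ht using 1
      field_simp
      ring
    · convert hs' using 1
      field_simp
      ring
  · rintro ⟨h1, h2⟩
    refine ⟨_, h2, _, h1, ?_⟩
    ext i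
    fin_cases i
    · simp [basisFst, basisSnd]
      field_simp
      ring
    · simp [basisFst, basisSnd]
      field_simp

/-- The half-open rectangle with sides `1/√b` and `√b` centred at the origin. It is a fundamental
domain of `L_{a,b}` for every `a`. -/
def rectangle (b : ℝ) : Set Plane :=
  {x | x 1 / √b ∈ Ico (-(1 / 2) : ℝ) (1 / 2) ∧ x 0 * √b ∈ Ico (-(1 / 2) : ℝ) (1 / 2)}

theorem isAddFundamentalDomain_rectangle (a : ℝ) {b : ℝ} (hb : 0 < b) :
    IsAddFundamentalDomain (lattice a b) (rectangle b) := by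
  convert isAddFundamentalDomain_of_shear a hb (-(1 / 2)) (-(1 / 2)) (θ := fun _ => 0)
    (by fun_prop) using 1
  norm_num [rectangle]

/-- The closed Voronoi cell of the origin in `L_{a,b}`. -/
def voronoi (a b : ℝ) : Set Plane := {x | ∀ v ∈ lattice a b, ‖x‖ ≤ ‖x - v‖}

theorem isClosed_voronoi (a b : ℝ) : IsClosed (voronoi a b) := by
  simp only [voronoi, ofPred_forall]
  exact isClosed_biInter fun v _ => isClosed_le (by fun_prop) (by fun_prop)

theorem measurableSet_voronoi (a b : ℝ) : MeasurableSet (voronoi a b) :=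
  (isClosed_voronoi a b).measurableSet

theorem norm_mk_eq_of_mem_voronoi {a b : ℝ} {x : Plane} (hx : x ∈ voronoi a b) :
    ‖(x : FlatTorus a b)‖ = ‖x‖ := by
  rw [QuotientAddGroup.norm_mk]
  refine le_antisymm ?_ ?_
  · simpa using Metric.infDist_le_dist_of_mem (x := x) (zero_mem (lattice a b))
  · rw [Metric.le_infDist ⟨0, zero_mem (lattice a b)⟩]
    intro v hv
    rw [dist_eq_norm]
    exact hx v hv

theorem volume_norm_eq_norm_add {v : Plane} (hv : v ≠ 0) :
    volume {x : Plane | ‖x‖ = ‖x + v‖} = 0 := by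
  have h : {x : Plane | ‖x‖ = ‖x + v‖}
      = (AffineSubspace.mk' (-(1 / 2 : ℝ) • v) (ℝ ∙ v)ᗮ : Set Plane) := by
    ext x
    rw [SetLike.mem_coe, AffineSubspace.mem_mk', Submodule.mem_orthogonal_singleton_iff_inner_right,
      mem_ofPred_eq, ← sq_eq_sq₀ (norm_nonneg _) (norm_nonneg _), norm_add_sq_real]
    simp only [vsub_eq_sub, inner_sub_right, inner_smul_right, real_inner_self_eq_norm_sq]
    rw [real_inner_comm]
    constructor <;> intro h <;> linarith
  rw [h]
  refine Measure.addHaar_affineSubspace _ _ fun htop => hv ?_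
  have h1 : (ℝ ∙ v)ᗮ = ⊤ := by
    have := congrArg AffineSubspace.direction htop
    rwa [AffineSubspace.direction_mk', AffineSubspace.direction_top] at this
  have h2 : v ∈ (ℝ ∙ v)ᗮ := h1 ▸ Submodule.mem_top
  rw [Submodule.mem_orthogonal_singleton_iff_inner_right] at h2
  exact inner_self_eq_zero.1 h2

theorem isAddFundamentalDomain_voronoi (a : ℝ) {b : ℝ} (hb : 0 < b) :
    IsAddFundamentalDomain (lattice a b) (voronoi a b) where
  nullMeasurableSet := (measurableSet_voronoi a b).nullMeasurableSet
  ae_covers := by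
    refine Eventually.of_forall fun x => ?_
    obtain ⟨v, hv, h⟩ :=
      (isClosed_lattice a hb).exists_infDist_eq_dist ⟨0, zero_mem (lattice a b)⟩ x
    refine ⟨-⟨v, hv⟩, fun w hw => ?_⟩
    change ‖-v + x‖ ≤ ‖-v + x - w‖
    have := Metric.infDist_le_dist_of_mem (x := x) (add_mem hv hw)
    rw [h, dist_eq_norm, dist_eq_norm] at this
    rwa [← sub_eq_neg_add, sub_sub]
  aedisjoint := by
    rintro ⟨v, hv⟩ ⟨w, hw⟩ hvw
    have hne : v - w ≠ 0 := by
      rw [sub_ne_zero]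
      exact fun h => hvw (Subtype.ext h)
    -- a point of two translates of the cell is equidistant from two lattice points
    refine measure_mono_null ?_ ((measure_preimage_add_right volume (-v) _).trans
      (volume_norm_eq_norm_add hne))
    rintro x ⟨⟨y, hy, rfl⟩, ⟨z, hz, h⟩⟩
    change w + z = v + y at h
    change ‖v + y + -v‖ = ‖v + y + -v + (v - w)‖
    have h1 := hy (w - v) (sub_mem hw hv)
    have h2 := hz (v - w) (sub_mem hv hw)
    have e : z = y + (v - w) := by
      rw [eq_sub_of_add_eq' h]
      abel
    rw [e] at h2
    have e1 : v + y + -v = y := by abel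
    have e2 : y - (w - v) = y + (v - w) := by abel
    have e3 : y + (v - w) - (v - w) = y := by abel
    rw [e2] at h1
    rw [e3] at h2
    rw [e1]
    exact le_antisymm h1 h2

theorem volume_rectangle {b : ℝ} (hb : 0 < b) : volume (rectangle b) = 1 := by
  have hs : 0 < √b := Real.sqrt_pos.2 hb
  have h : rectangle b = (MeasurableEquiv.toLp 2 (Fin 2 → ℝ)).symm ⁻¹'
      (univ.pi ![Ico (-(1 / 2) / √b) ((1 / 2) / √b), Ico (-(1 / 2) * √b) ((1 / 2) * √b)]) := by
    ext x
    simp only [rectangle, mem_ofPred_eq, mem_preimage, Set.mem_pi, mem_univ, true_imp_iff,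
      Fin.forall_fin_two, Matrix.cons_val_zero, Matrix.cons_val_one, mem_Ico,
      div_le_iff₀ hs, lt_div_iff₀ hs, le_div_iff₀ hs, div_lt_iff₀ hs]
    rw [and_comm]
    rfl
  rw [h, (EuclideanSpace.volume_preserving_symm_measurableEquiv_toLp (Fin 2)).measure_preimage
    ?_, volume_pi_pi]
  · simp only [Fin.prod_univ_two, Matrix.cons_val_zero, Matrix.cons_val_one, Real.volume_Ico]
    rw [← ENNReal.ofReal_mul (by field_simp; norm_num)]
    convert ENNReal.ofReal_one using 2
    field_simp
    norm_num
  · refine (MeasurableSet.univ_pi fun i => ?_).nullMeasurableSet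
    fin_cases i <;> exact measurableSet_Ico

theorem volume_voronoi (a : ℝ) {b : ℝ} (hb : 0 < b) : volume (voronoi a b) = 1 := by
  rw [← volume_rectangle hb]
  exact (isAddFundamentalDomain_voronoi a hb).measure_eq (isAddFundamentalDomain_rectangle a hb)

/-! ### Integration on the torus -/

theorem mk_vadd {a b : ℝ} (v : lattice a b) (x : Plane) :
    ((v +ᵥ x : Plane) : FlatTorus a b) = x := by
  change ((v + x : Plane) : FlatTorus a b) = x
  rw [add_comm, QuotientAddGroup.mk_add_of_mem x v.2]

/-- The integral over the torus can be computed over any fundamental domain. -/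
theorem lintegral_torusMeasure (a : ℝ) {b : ℝ} (hb : 0 < b) {D : Set Plane}
    (hD : IsAddFundamentalDomain (lattice a b) D) {Φ : FlatTorus a b → ℝ≥0∞} (hΦ : Measurable Φ) :
    ∫⁻ x, Φ x ∂torusMeasure a b = ∫⁻ x in D, Φ (x : FlatTorus a b) := by
  rw [torusMeasure, lintegral_map hΦ QuotientAddGroup.measurable_coe]
  exact (isAddFundamentalDomain_parallelogram a hb).setLIntegral_eq hD _
    fun v x => by rw [mk_vadd]

/-- The area measure is translation invariant. -/
theorem lintegral_torusMeasure_sub (a : ℝ) {b : ℝ} (hb : 0 < b) (z : FlatTorus a b)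
    {Φ : FlatTorus a b → ℝ≥0∞} (hΦ : Measurable Φ) :
    ∫⁻ x, Φ (x - z) ∂torusMeasure a b = ∫⁻ x, Φ x ∂torusMeasure a b := by
  obtain ⟨w, rfl⟩ := QuotientAddGroup.mk_surjective z
  have hmk : Measurable ((↑) : Plane → FlatTorus a b) := QuotientAddGroup.measurable_coe
  have hΦ' : Measurable fun x : FlatTorus a b => Φ (x - w) := by
    refine measurable_from_quotient.2 ?_
    exact (hΦ.comp hmk).comp (measurable_sub_const w)
  have hP := isAddFundamentalDomain_parallelogram a hb
  have hD : IsAddFundamentalDomain (lattice a b)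
      ((fun x : Plane => x + w) ⁻¹' parallelogram a b) := by
    refine hP.preimage_of_equiv (measurePreserving_add_right volume w).quasiMeasurePreserving
      (e := id) Function.bijective_id fun v x => ?_
    change v + x + w = v + (x + w)
    abel
  rw [lintegral_torusMeasure a hb hP hΦ', lintegral_torusMeasure a hb hD hΦ]
  have h := (measurePreserving_add_right (volume : Measure Plane) w).setLIntegral_comp_preimage_emb
    (measurableEmbedding_addRight w) (fun x : Plane => Φ ((x - w : Plane) : FlatTorus a b))
    (parallelogram a b)
  simp only [add_sub_cancel_right] at h
  exact h.symm

theorem measurable_norm_torus (a b : ℝ) : Measurable fun x : FlatTorus a b => ‖x‖ := by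
  refine measurable_from_quotient.2 ?_
  have : ((fun x : FlatTorus a b => ‖x‖) ∘ Quotient.mk'' : Plane → ℝ)
      = fun x => Metric.infDist x (lattice a b : Set Plane) := by
    funext x
    exact QuotientAddGroup.norm_mk x
  rw [this]
  exact (Metric.continuous_infDist_pt _).measurable

/-- Radial integrals on the torus are integrals over the Voronoi cell. -/
theorem lintegral_norm_torusMeasure (a : ℝ) {b : ℝ} (hb : 0 < b) {φ : ℝ → ℝ≥0∞}
    (hφ : Measurable φ) :
    ∫⁻ x, φ ‖x‖ ∂torusMeasure a b = ∫⁻ x in voronoi a b, φ ‖x‖ := by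
  refine (lintegral_torusMeasure a hb (isAddFundamentalDomain_voronoi a hb)
    (hφ.comp (measurable_norm_torus a b))).trans ?_
  exact setLIntegral_congr_fun (measurableSet_voronoi a b)
    fun x hx => congrArg φ (norm_mk_eq_of_mem_voronoi hx)

theorem torusMeasure_univ (a : ℝ) {b : ℝ} (hb : 0 < b) : torusMeasure a b univ = 1 := by
  have h := lintegral_norm_torusMeasure a hb (φ := fun _ => 1) measurable_const
  simpa [volume_voronoi a hb] using h

/-! ### Circular segments -/

/-- The total area of the two segments that the lines `x₀ = ±√A/2` cut off from the disc of
radius `r` about the origin. For a lattice vector `v` with `‖v‖² = A`, this is the part of the disc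
beyond the perpendicular bisectors of `0, v` and of `0, -v`. -/
def segmentArea (r A : ℝ) : ℝ := volume.real {x : Plane | x ∈ Metric.ball 0 r ∧ √A / 2 < |x 0|}

theorem integrable_sqrt_sub_sq (r : ℝ) : Integrable fun t : ℝ => 2 * √(r ^ 2 - t ^ 2) := by
  refine Continuous.integrable_of_hasCompactSupport (by fun_prop) ?_
  refine HasCompactSupport.of_support_subset_isCompact (isCompact_Icc (a := -|r|) (b := |r|)) ?_
  intro t ht
  rw [Function.mem_support] at ht
  have h : 0 < r ^ 2 - t ^ 2 := by
    by_contra hcon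
    exact ht (by rw [Real.sqrt_eq_zero_of_nonpos (not_lt.1 hcon), mul_zero])
  exact abs_le.1 (sq_le_sq.1 (by linarith))

theorem segmentArea_eq_integral {r : ℝ} (hr : 0 ≤ r) (A : ℝ) :
    segmentArea r A = ∫ t in √A / 2..r, 4 * √(r ^ 2 - t ^ 2) := by
  set h := √A / 2 with hh
  have h0 : 0 ≤ h := by positivity
  set s : Set ℝ := {t | h < |t|} with hs
  have hsm : MeasurableSet s := measurableSet_lt measurable_const (by fun_prop)
  set g : ℝ → ℝ := fun t => √(r ^ 2 - t ^ 2) with hg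
  have hint := integrable_sqrt_sub_sq r
  have hgi : Integrable g := by
    have := hint.const_mul (1 / 2)
    simpa using this
  have hset : {x : Plane | x ∈ Metric.ball 0 r ∧ h < |x 0|}
      = (MeasurableEquiv.toLp 2 (Fin 2 → ℝ)).symm ⁻¹' (MeasurableEquiv.finTwoArrow ⁻¹'
        regionBetween (-g) g s) := by
    ext x
    change (x ∈ Metric.ball 0 r ∧ h < |x 0|) ↔ (h < |x 0| ∧ x 1 ∈ Ioo (-g (x 0)) (g (x 0)))
    rw [and_comm, and_congr_right_iff]
    intro _
    rw [mem_ball_zero_iff, ← sq_lt_sq₀ (norm_nonneg _) hr, norm_sq_eq_coords, mem_Ioo, ← abs_lt,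
      Real.lt_sqrt (abs_nonneg _), sq_abs]
    constructor <;> intro h <;> linarith
  have hvol : segmentArea r A = ∫ t in s, 2 * √(r ^ 2 - t ^ 2) := by
    rw [segmentArea, ← hh, hset, Measure.real,
      (EuclideanSpace.volume_preserving_symm_measurableEquiv_toLp (Fin 2)).measure_preimage_equiv,
      (volume_preserving_finTwoArrow ℝ).measure_preimage_equiv, Measure.volume_eq_prod,
      volume_regionBetween_eq_integral hgi.neg.integrableOn hgi.integrableOn hsm
        (fun t _ => by
          have : 0 ≤ g t := Real.sqrt_nonneg _
          rw [Pi.neg_apply]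
          linarith), ENNReal.toReal_ofReal]
    · refine setIntegral_congr_fun hsm fun t _ => ?_
      simp only [Pi.sub_apply, Pi.neg_apply, hg]
      ring
    · refine setIntegral_nonneg hsm fun t _ => ?_
      simp only [Pi.sub_apply, Pi.neg_apply, hg]
      have : 0 ≤ √(r ^ 2 - t ^ 2) := Real.sqrt_nonneg _
      linarith
  rw [hvol, ← integral_indicator hsm]
  have habs := integral_comp_abs (f := (Ioi h).indicator fun t : ℝ => 2 * √(r ^ 2 - t ^ 2))
  have e1 : (fun t : ℝ => (Ioi h).indicator (fun t : ℝ => 2 * √(r ^ 2 - t ^ 2)) |t|)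
      = s.indicator fun t : ℝ => 2 * √(r ^ 2 - t ^ 2) := by
    funext t
    simp only [indicator_apply, mem_Ioi, sq_abs]
    rfl
  rw [e1] at habs
  rw [habs, setIntegral_indicator measurableSet_Ioi,
    inter_eq_right.2 (Ioi_subset_Ioi h0), ← integral_const_mul]
  have e2 : ∀ t : ℝ, 2 * (2 * √(r ^ 2 - t ^ 2)) = 4 * √(r ^ 2 - t ^ 2) := fun t => by ring
  simp only [e2]
  have hint4 : Integrable fun t : ℝ => 4 * √(r ^ 2 - t ^ 2) := by
    simpa only [e2] using hint.const_mul 2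
  have hzero : ∀ t, r ≤ t → 4 * √(r ^ 2 - t ^ 2) = 0 := fun t ht => by
    rw [Real.sqrt_eq_zero_of_nonpos (by nlinarith), mul_zero]
  rcases le_total h r with hle | hle
  · rw [intervalIntegral.integral_of_le hle, ← Ioc_union_Ioi_eq_Ioi hle,
      setIntegral_union (Ioc_disjoint_Ioi le_rfl) measurableSet_Ioi hint4.integrableOn
        hint4.integrableOn,
      setIntegral_eq_zero_of_forall_eq_zero (t := Ioi r) (fun t ht => hzero t (le_of_lt ht)),
      add_zero]
  · rw [intervalIntegral.integral_of_ge hle,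
      setIntegral_eq_zero_of_forall_eq_zero (t := Ioi h)
        (fun t ht => hzero t (hle.trans (le_of_lt ht))),
      setIntegral_eq_zero_of_forall_eq_zero (t := Ioc r h) (fun t ht => hzero t ht.1.le), neg_zero]

/-- The rate of change of the segment area. The square root is `0` when the lines miss the disc. -/
theorem hasDerivAt_segmentArea {r : ℝ} (hr : 0 ≤ r) {A : ℝ} (hA : 0 < A) :
    HasDerivAt (segmentArea r) (-√(r ^ 2 / A - 1 / 4)) A := by
  have hc : Continuous fun t : ℝ => 4 * √(r ^ 2 - t ^ 2) := by fun_prop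
  have h1 : HasDerivAt (fun u => ∫ t in u..r, 4 * √(r ^ 2 - t ^ 2))
      (-(4 * √(r ^ 2 - (√A / 2) ^ 2))) (√A / 2) :=
    intervalIntegral.integral_hasDerivAt_left (hc.intervalIntegrable _ _)
      (hc.stronglyMeasurableAtFilter _ _) hc.continuousAt
  have h2 : HasDerivAt (fun A => √A / 2) (1 / (2 * √A) / 2) A :=
    (Real.hasDerivAt_sqrt hA.ne').div_const 2
  have h3 := h1.comp A h2
  have hs : 0 < √A := Real.sqrt_pos.2 hA
  have e : r ^ 2 / A - 1 / 4 = (r ^ 2 - (√A / 2) ^ 2) / A := by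
    rw [div_pow, Real.sq_sqrt hA.le]
    field_simp
    ring
  rw [e, Real.sqrt_div' _ hA.le]
  have hf : segmentArea r = (fun u => ∫ t in u..r, 4 * √(r ^ 2 - t ^ 2)) ∘ fun A => √A / 2 :=
    funext fun A => segmentArea_eq_integral hr A
  rw [hf]
  refine h3.congr_deriv ?_
  field_simp
  norm_num

theorem segmentArea_nonneg (r A : ℝ) : 0 ≤ segmentArea r A := measureReal_nonneg

theorem segmentArea_eq_zero {r A : ℝ} (h : 4 * r ^ 2 ≤ A) : segmentArea r A = 0 := by
  have : {x : Plane | x ∈ Metric.ball 0 r ∧ √A / 2 < |x 0|} = ∅ := by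
    refine eq_empty_of_forall_notMem fun x ⟨hx, hx'⟩ => ?_
    rw [mem_ball_zero_iff] at hx
    have h1 : ‖x‖ ^ 2 < r ^ 2 := by
      have := norm_nonneg x
      gcongr
    rw [norm_sq_eq_coords] at h1
    have h2 : (√A / 2) ^ 2 < |x 0| ^ 2 := by gcongr
    rw [div_pow, Real.sq_sqrt (by nlinarith), sq_abs] at h2
    nlinarith [sq_nonneg (x 1)]
  rw [segmentArea, this, measureReal_empty]

theorem segmentArea_lt {r A B : ℝ} (hr : 0 ≤ r) (hA : 0 ≤ A) (hAB : A < B) (hA' : A < 4 * r ^ 2) :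
    segmentArea r B < segmentArea r A := by
  have hanti : StrictAntiOn (segmentArea r) (Icc A (min B (4 * r ^ 2))) := by
    refine strictAntiOn_of_deriv_neg (convex_Icc _ _) ?_ ?_
    · have : Continuous (segmentArea r) := by
        have hc : Continuous fun t : ℝ => 4 * √(r ^ 2 - t ^ 2) := by fun_prop
        have hf : segmentArea r = fun A => -∫ t in r..√A / 2, 4 * √(r ^ 2 - t ^ 2) := by
          funext A
          rw [segmentArea_eq_integral hr, intervalIntegral.integral_symm]
        rw [hf]
        exact ((intervalIntegral.continuous_primitive
          (fun a b => hc.intervalIntegrable a b) r).comp (by fun_prop)).neg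
      exact this.continuousOn
    · rw [interior_Icc]
      intro x hx
      have hx0 : 0 < x := hA.trans_lt hx.1
      rw [(hasDerivAt_segmentArea hr hx0).deriv, neg_lt_zero, Real.sqrt_pos, sub_pos,
        div_lt_div_iff₀ (by norm_num) hx0]
      have := hx.2.trans_le (min_le_right _ _)
      linarith
  have h1 : A < min B (4 * r ^ 2) := lt_min hAB hA'
  have h2 := hanti (left_mem_Icc.2 h1.le) (right_mem_Icc.2 h1.le) h1
  refine lt_of_le_of_lt ?_ h2
  refine measureReal_mono (fun x hx => ⟨hx.1, lt_of_le_of_lt ?_ hx.2⟩)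
    (ne_top_of_le_ne_top (measure_ball_lt_top (x := (0 : Plane)) (r := r)).ne
      (measure_mono fun x hx => hx.1))
  have := Real.sqrt_le_sqrt (min_le_left B (4 * r ^ 2))
  linarith

/-- The part of the disc of radius `r` beyond the bisectors of `0, v` and of `0, -v`. -/
def segments (r : ℝ) (v : Plane) : Set Plane :=
  {x | x ∈ Metric.ball 0 r ∧ ‖v‖ ^ 2 / 2 < |inner ℝ x v|}

theorem measurableSet_segments (r : ℝ) (v : Plane) : MeasurableSet (segments r v) := by
  have h : MeasurableSet {x : Plane | ‖v‖ ^ 2 / 2 < |inner ℝ x v|} :=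
    measurableSet_lt measurable_const (by fun_prop)
  exact measurableSet_ball.inter h

theorem segments_subset (r : ℝ) (v : Plane) : segments r v ⊆ Metric.ball 0 r := fun _ h => h.1

/-- By rotation invariance the area only depends on `‖v‖`. -/
theorem volume_segments (r : ℝ) {v : Plane} (hv : v ≠ 0) :
    volume.real (segments r v) = segmentArea r (‖v‖ ^ 2) := by
  set w : Plane := !₂[‖v‖, 0] with hw
  have hn : 0 < ‖v‖ := norm_pos_iff.2 hv
  have hw0 : w 0 = ‖v‖ := rfl
  have hw1 : w 1 = 0 := rfl
  have hvw : ‖v‖ = ‖w‖ := by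
    rw [← sq_eq_sq₀ (norm_nonneg _) (norm_nonneg _), norm_sq_eq_coords w, hw0, hw1]
    ring
  set ρ := (ℝ ∙ (v - w))ᗮ.reflection with hρ
  have hρv : ρ v = w := Submodule.reflection_sub hvw
  have h : segments r v = ρ ⁻¹' {x : Plane | x ∈ Metric.ball 0 r ∧ √(‖v‖ ^ 2) / 2 < |x 0|} := by
    ext x
    change (x ∈ Metric.ball 0 r ∧ _) ↔ (ρ x ∈ Metric.ball 0 r ∧ _)
    rw [mem_ball_zero_iff, mem_ball_zero_iff, ρ.norm_map, ← ρ.inner_map_map x v, hρv,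
      inner_eq_coords, hw0, hw1, mul_zero, add_zero, abs_mul, abs_of_pos hn,
      Real.sqrt_sq hn.le, and_congr_right_iff]
    intro _
    constructor <;> intro h <;> nlinarith
  rw [h, segmentArea, Measure.real, Measure.real,
    ρ.measurePreserving.measure_preimage]
  have h' : MeasurableSet {x : Plane | √(‖v‖ ^ 2) / 2 < |x 0|} :=
    measurableSet_lt measurable_const (by fun_prop)
  exact (measurableSet_ball.inter h').nullMeasurableSet

/-! ### The Voronoi cell and its bisectors -/

theorem basisFst_mem_lattice (a b : ℝ) : basisFst b ∈ lattice a b :=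
  AddSubgroup.subset_closure (by simp)

theorem basisSnd_mem_lattice (a b : ℝ) : basisSnd a b ∈ lattice a b :=
  AddSubgroup.subset_closure (by simp)

theorem norm_sq_basisFst {b : ℝ} (hb : 0 < b) : ‖basisFst b‖ ^ 2 = 1 / b := by
  rw [norm_sq_eq_coords, basisFst_zero, basisFst_one, div_pow, Real.sq_sqrt hb.le]
  ring

theorem norm_sq_basisSnd (a : ℝ) {b : ℝ} (hb : 0 < b) :
    ‖basisSnd a b‖ ^ 2 = (a ^ 2 + b ^ 2) / b := by
  rw [norm_sq_eq_coords, basisSnd_zero, basisSnd_one, div_pow, Real.sq_sqrt hb.le]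
  field_simp

theorem inner_basisFst_basisSnd (a : ℝ) {b : ℝ} (hb : 0 < b) :
    inner ℝ (basisFst b) (basisSnd a b) = a / b := by
  have hs := Real.sq_sqrt hb.le
  rw [inner_eq_coords, basisFst_zero, basisFst_one, basisSnd_zero]
  rw [div_mul_div_comm, ← pow_two, hs]
  ring

theorem norm_sq_basisSnd_sub_basisFst (a : ℝ) {b : ℝ} (hb : 0 < b) :
    ‖basisSnd a b - basisFst b‖ ^ 2 = ((1 - a) ^ 2 + b ^ 2) / b := by
  rw [norm_sub_sq_real, real_inner_comm, inner_basisFst_basisSnd a hb, norm_sq_basisFst hb,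
    norm_sq_basisSnd a hb]
  field_simp
  ring

theorem ne_zero_of_norm_sq_pos {v : Plane} (h : 0 < ‖v‖ ^ 2) : v ≠ 0 := by
  rintro rfl
  simp at h

theorem abs_inner_le_of_mem_voronoi {a b : ℝ} {x v : Plane} (hx : x ∈ voronoi a b)
    (hv : v ∈ lattice a b) : |inner ℝ x v| ≤ ‖v‖ ^ 2 / 2 := by
  have key : ∀ w ∈ lattice a b, inner ℝ x w ≤ ‖w‖ ^ 2 / 2 := by
    intro w hw
    have h := hx w hw
    rw [← sq_le_sq₀ (norm_nonneg _) (norm_nonneg _), norm_sub_sq_real] at h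
    linarith
  have h1 := key v hv
  have h2 := key (-v) (neg_mem hv)
  rw [inner_neg_right, norm_neg] at h2
  exact abs_le.2 ⟨by linarith, h1⟩

theorem mem_voronoi_of_forall_int {a b : ℝ} {x : Plane}
    (h : ∀ m n : ℤ, (m : ℝ) * inner ℝ x (basisFst b) + n * inner ℝ x (basisSnd a b)
      ≤ ‖m • basisFst b + n • basisSnd a b‖ ^ 2 / 2) : x ∈ voronoi a b := by
  intro v hv
  obtain ⟨m, n, rfl⟩ := mem_lattice_iff.1 hv
  rw [← sq_le_sq₀ (norm_nonneg _) (norm_nonneg _), norm_sub_sq_real, inner_add_right,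
    ← Int.cast_smul_eq_zsmul ℝ, ← Int.cast_smul_eq_zsmul ℝ, inner_smul_right, inner_smul_right]
  have := h m n
  rw [← Int.cast_smul_eq_zsmul ℝ, ← Int.cast_smul_eq_zsmul ℝ] at this
  linarith

theorem norm_sq_zsmul_add_zsmul (a : ℝ) {b : ℝ} (hb : 0 < b) (m n : ℤ) :
    ‖m • basisFst b + n • basisSnd a b‖ ^ 2
      = (m : ℝ) ^ 2 * (1 / b) + (n : ℝ) ^ 2 * ((a ^ 2 + b ^ 2) / b) + 2 * m * n * (a / b) := by
  rw [norm_sq_eq_coords, zsmul_add_zsmul_zero, zsmul_add_zsmul_one, div_pow, mul_pow,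
    Real.sq_sqrt hb.le]
  field_simp
  ring

/-- In an obtuse superbase, the bisectors of the six shortest vectors imply all the others: any
lattice vector is a nonnegative combination of two neighbouring ones, which form a non-obtuse angle. -/
theorem int_combination_le {A B c X Y : ℝ} (hc : 0 ≤ c) (hcA : c ≤ A) (hcB : c ≤ B)
    (hX : |X| ≤ A / 2) (hY : |Y| ≤ B / 2) (hXY : |X - Y| ≤ (A + B - 2 * c) / 2) (m n : ℤ) :
    m * X + n * Y ≤ ((m : ℝ) ^ 2 * A + (n : ℝ) ^ 2 * B + 2 * m * n * c) / 2 := by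
  have hA : 0 ≤ A := hc.trans hcA
  have hB : 0 ≤ B := hc.trans hcB
  have hC : 0 ≤ A + B - 2 * c := by linarith
  obtain ⟨hX1, hX2⟩ := abs_le.1 hX
  obtain ⟨hY1, hY2⟩ := abs_le.1 hY
  obtain ⟨hZ1, hZ2⟩ := abs_le.1 hXY
  -- the two neighbouring vectors `v`, `w` enter with natural coefficients `i`, `j`
  have key : ∀ (P Q d S T : ℝ), 0 ≤ P → 0 ≤ Q → 0 ≤ d → S ≤ P / 2 → T ≤ Q / 2 →
      ∀ i j : ℕ, i * S + j * T ≤ ((i : ℝ) ^ 2 * P + (j : ℝ) ^ 2 * Q + 2 * i * j * d) / 2 := by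
    intro P Q d S T hP hQ hd hS hT i j
    have sq : ∀ k : ℕ, (k : ℝ) ≤ (k : ℝ) ^ 2 := fun k => by
      exact_mod_cast Nat.le_self_pow two_ne_zero k
    have hi := mul_le_mul_of_nonneg_right (sq i) hP
    have hj := mul_le_mul_of_nonneg_right (sq j) hQ
    have hi' := mul_le_mul_of_nonneg_left hS (Nat.cast_nonneg (α := ℝ) i)
    have hj' := mul_le_mul_of_nonneg_left hT (Nat.cast_nonneg (α := ℝ) j)
    have hij : 0 ≤ (i : ℝ) * j * d := by positivity
    nlinarith
  rcases le_total 0 m with hm | hm <;> rcases le_total 0 n with hn | hn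
  · lift m to ℕ using hm
    lift n to ℕ using hn
    exact_mod_cast key A B c X Y hA hB hc hX2 hY2 m n
  · obtain ⟨k, rfl⟩ := Int.eq_ofNat_of_zero_le (neg_nonneg.2 hn) |>.imp
      fun k hk => (neg_eq_iff_eq_neg.1 hk)
    lift m to ℕ using hm
    rcases le_total k m with hkm | hkm
    · obtain ⟨i, rfl⟩ := Nat.exists_eq_add_of_le hkm
      have := key A (A + B - 2 * c) (A - c) X (X - Y) hA hC (by linarith) hX2 (by linarith) i k
      push_cast
      linarith
    · obtain ⟨i, rfl⟩ := Nat.exists_eq_add_of_le hkm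
      have := key B (A + B - 2 * c) (B - c) (-Y) (X - Y) hB hC (by linarith) (by linarith)
        (by linarith) i m
      push_cast
      linarith
  · obtain ⟨k, rfl⟩ := Int.eq_ofNat_of_zero_le (neg_nonneg.2 hm) |>.imp
      fun k hk => (neg_eq_iff_eq_neg.1 hk)
    lift n to ℕ using hn
    rcases le_total k n with hkn | hkn
    · obtain ⟨i, rfl⟩ := Nat.exists_eq_add_of_le hkn
      have := key B (A + B - 2 * c) (B - c) Y (Y - X) hB hC (by linarith) hY2
        (by linarith) i k
      push_cast
      linarith
    · obtain ⟨i, rfl⟩ := Nat.exists_eq_add_of_le hkn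
      have := key A (A + B - 2 * c) (A - c) (-X) (Y - X) hA hC (by linarith) (by linarith)
        (by linarith) i n
      push_cast
      linarith
  · obtain ⟨k, rfl⟩ := Int.eq_ofNat_of_zero_le (neg_nonneg.2 hm) |>.imp
      fun k hk => (neg_eq_iff_eq_neg.1 hk)
    obtain ⟨l, rfl⟩ := Int.eq_ofNat_of_zero_le (neg_nonneg.2 hn) |>.imp
      fun k hk => (neg_eq_iff_eq_neg.1 hk)
    have := key A B c (-X) (-Y) hA hB hc (by linarith) (by linarith) k l
    push_cast
    linarith

/-- The Voronoi cell of a reduced lattice contains the hexagon cut out by the bisectors of the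
shortest vectors. -/
theorem mem_voronoi_of_abs_inner_le {a b : ℝ} (hb : 0 < b) (ha : 0 ≤ a) (ha1 : a ≤ 1)
    (hab : a ≤ a ^ 2 + b ^ 2) {x : Plane} (h1 : |inner ℝ x (basisFst b)| ≤ 1 / b / 2)
    (h2 : |inner ℝ x (basisSnd a b)| ≤ (a ^ 2 + b ^ 2) / b / 2)
    (h3 : |inner ℝ x (basisSnd a b - basisFst b)| ≤ ((1 - a) ^ 2 + b ^ 2) / b / 2) :
    x ∈ voronoi a b := by
  refine mem_voronoi_of_forall_int fun m n => ?_
  rw [norm_sq_zsmul_add_zsmul a hb]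
  refine int_combination_le (by positivity) (by gcongr) (by gcongr) h1 h2 ?_ m n
  rw [abs_sub_comm, ← inner_sub_right]
  convert h3 using 2
  field_simp
  ring

/-- The mirror image of `mem_voronoi_of_abs_inner_le`, for `a ≤ 0`. -/
theorem mem_voronoi_of_abs_inner_le' {a b : ℝ} (hb : 0 < b) (ha : a ≤ 0) (ha1 : -a ≤ 1)
    (hab : -a ≤ a ^ 2 + b ^ 2) {x : Plane} (h1 : |inner ℝ x (basisFst b)| ≤ 1 / b / 2)
    (h2 : |inner ℝ x (basisSnd a b)| ≤ (a ^ 2 + b ^ 2) / b / 2)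
    (h3 : |inner ℝ x (basisSnd a b + basisFst b)| ≤ ((1 + a) ^ 2 + b ^ 2) / b / 2) :
    x ∈ voronoi a b := by
  refine mem_voronoi_of_forall_int fun m n => ?_
  rw [norm_sq_zsmul_add_zsmul a hb]
  have := int_combination_le (A := 1 / b) (B := (a ^ 2 + b ^ 2) / b) (c := -a / b)
    (Y := -inner ℝ x (basisSnd a b)) (div_nonneg (by linarith) hb.le)
    (by gcongr) (by gcongr) h1 (by rwa [abs_neg]) ?_ m (-n)
  · push_cast at this
    linear_combination this
  · rw [sub_neg_eq_add, add_comm, ← inner_add_right]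
    convert h3 using 2
    field_simp
    ring

/-- A point beyond the bisectors of two vectors spanning a unit parallelogram is at least as far
from the origin as the circumcentre of the (non-obtuse) triangle they span. -/
theorem disjoint_segments {r : ℝ} (hr : 0 ≤ r) {v w : Plane}
    (hdet : (v 0 * w 1 - v 1 * w 0) ^ 2 = 1) (hv : |inner ℝ v w| ≤ ‖v‖ ^ 2)
    (hw : |inner ℝ v w| ≤ ‖w‖ ^ 2)
    (hR : 4 * r ^ 2 ≤ ‖v‖ ^ 2 * ‖w‖ ^ 2 * (‖v‖ ^ 2 + ‖w‖ ^ 2 - 2 * |inner ℝ v w|)) :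
    Disjoint (segments r v) (segments r w) := by
  rw [Set.disjoint_left]
  rintro x ⟨hx, hxv⟩ ⟨-, hxw⟩
  rw [mem_ball_zero_iff, ← sq_lt_sq₀ (norm_nonneg _) hr] at hx
  set A := ‖v‖ ^ 2 with hA
  set B := ‖w‖ ^ 2 with hB
  set c := inner ℝ v w with hc
  set X := inner ℝ x v with hX
  set Y := inner ℝ x w with hY
  have hgram : ‖x‖ ^ 2 = B * X ^ 2 - 2 * c * (X * Y) + A * Y ^ 2 := by
    rw [hX, hY, hc, hA, hB, inner_eq_coords, inner_eq_coords, inner_eq_coords, norm_sq_eq_coords,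
      norm_sq_eq_coords, norm_sq_eq_coords]
    linear_combination (-(x 0 ^ 2 + x 1 ^ 2)) * hdet
  have hk := abs_nonneg c
  have h1 : c * (X * Y) ≤ |c| * (|X| * |Y|) := by
    rw [← abs_mul, ← abs_mul]
    exact le_abs_self _
  rw [← sq_abs X, ← sq_abs Y] at hgram
  generalize |X| = X' at *
  generalize |Y| = Y' at *
  generalize |c| = k at *
  obtain ⟨s, rfl⟩ : ∃ s, X' = A / 2 + s := ⟨_, (add_sub_cancel _ _).symm⟩
  obtain ⟨t, rfl⟩ : ∃ t, Y' = B / 2 + t := ⟨_, (add_sub_cancel _ _).symm⟩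
  have hs : 0 ≤ s := by linarith
  have ht : 0 ≤ t := by linarith
  have e1 : 0 ≤ s * (B * (A - k)) :=
    mul_nonneg hs (mul_nonneg (hk.trans hw) (by linarith))
  have e2 : 0 ≤ t * (A * (B - k)) :=
    mul_nonneg ht (mul_nonneg (hk.trans hv) (by linarith))
  have e3 : 0 ≤ k * (s - t) ^ 2 := by positivity
  have e4 : 0 ≤ (B - k) * s ^ 2 := mul_nonneg (by linarith) (sq_nonneg _)
  have e5 : 0 ≤ (A - k) * t ^ 2 := mul_nonneg (by linarith) (sq_nonneg _)
  nlinarith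

/-! ### The area of the part of a torus at distance less than `r` from a point -/

/-- The area of the part of the Voronoi cell at distance less than `r` from the origin; this is
also the area of a ball of radius `r` in `T_{a,b}`. -/
def cellVolume (r a b : ℝ) : ℝ := volume.real (Metric.ball 0 r ∩ voronoi a b)

/-- The area of the Euclidean disc of radius `r`. -/
def discArea (r : ℝ) : ℝ := volume.real (Metric.ball (0 : Plane) r)

theorem volume_ball_ne_top (r : ℝ) : volume (Metric.ball (0 : Plane) r) ≠ ∞ :=
  measure_ball_lt_top.ne

theorem cellVolume_le_one (r a : ℝ) {b : ℝ} (hb : 0 < b) : cellVolume r a b ≤ 1 := by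
  have h : volume.real (voronoi a b) = 1 := by rw [Measure.real, volume_voronoi a hb]; rfl
  rw [← h]
  exact measureReal_mono inter_subset_right (by rw [volume_voronoi a hb]; exact ENNReal.one_ne_top)

theorem cellVolume_mono {r r' : ℝ} (h : r ≤ r') (a b : ℝ) :
    cellVolume r a b ≤ cellVolume r' a b :=
  measureReal_mono (inter_subset_inter_left _ (Metric.ball_subset_ball h))
    (measure_ne_top_of_subset inter_subset_left (volume_ball_ne_top r'))

theorem cellVolume_eq_one {R r a b : ℝ} (hb : 0 < b) (h : voronoi a b ⊆ Metric.closedBall 0 R)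
    (hr : R ≤ r) : cellVolume r a b = 1 := by
  have h1 : volume (Metric.ball 0 r ∩ voronoi a b) = volume (voronoi a b) := by
    refine measure_congr ?_
    have h0 : volume (Metric.sphere (0 : Plane) R) = 0 := Measure.addHaar_sphere _ _ _
    filter_upwards [measure_eq_zero_iff_ae_notMem.1 h0] with x hx
    refine propext ⟨fun hx' => hx'.2, fun hx' => ⟨?_, hx'⟩⟩
    rw [Metric.mem_sphere] at hx
    exact Metric.mem_ball.2 ((lt_of_le_of_ne (Metric.mem_closedBall.1 (h hx')) hx).trans_le hr)
  rw [cellVolume, Measure.real, h1, volume_voronoi a hb]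
  rfl

theorem volume_ball_sdiff_segments₂ {r : ℝ} {v w : Plane} (hv : v ≠ 0) (hw : w ≠ 0)
    (h : Disjoint (segments r v) (segments r w)) :
    volume.real (Metric.ball 0 r \ (segments r v ∪ segments r w))
      = discArea r - segmentArea r (‖v‖ ^ 2) - segmentArea r (‖w‖ ^ 2) := by
  have hfin := volume_ball_ne_top r
  rw [measureReal_sdiff (union_subset (segments_subset r v) (segments_subset r w))
      ((measurableSet_segments r v).union (measurableSet_segments r w)),
    measureReal_union h (measurableSet_segments r w)
      (measure_ne_top_of_subset (segments_subset r v) hfin)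
      (measure_ne_top_of_subset (segments_subset r w) hfin),
    volume_segments r hv, volume_segments r hw, discArea]
  ring

theorem volume_ball_sdiff_segments₃ {r : ℝ} {u v w : Plane} (hu : u ≠ 0) (hv : v ≠ 0) (hw : w ≠ 0)
    (huv : Disjoint (segments r u) (segments r v)) (huw : Disjoint (segments r u) (segments r w))
    (hvw : Disjoint (segments r v) (segments r w)) :
    volume.real (Metric.ball 0 r \ (segments r u ∪ segments r v ∪ segments r w))
      = discArea r - segmentArea r (‖u‖ ^ 2) - segmentArea r (‖v‖ ^ 2)
        - segmentArea r (‖w‖ ^ 2) := by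
  have hfin := volume_ball_ne_top r
  rw [← sdiff_sdiff, measureReal_sdiff
    (subset_sdiff.2 ⟨segments_subset r w, (huw.union_left hvw).symm⟩) (measurableSet_segments r w)
    (measure_ne_top_of_subset sdiff_subset hfin),
    volume_ball_sdiff_segments₂ hu hv huv, volume_segments r hw]

theorem le_volume_ball_sdiff_segments₃ {r : ℝ} {u v w : Plane} (hu : u ≠ 0) (hv : v ≠ 0)
    (hw : w ≠ 0) :
    discArea r - segmentArea r (‖u‖ ^ 2) - segmentArea r (‖v‖ ^ 2) - segmentArea r (‖w‖ ^ 2)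
      ≤ volume.real (Metric.ball 0 r \ (segments r u ∪ segments r v ∪ segments r w)) := by
  have hfin := volume_ball_ne_top r
  have hsub := union_subset (union_subset (segments_subset r u) (segments_subset r v))
    (segments_subset r w)
  rw [measureReal_sdiff hsub
    (((measurableSet_segments r u).union (measurableSet_segments r v)).union
      (measurableSet_segments r w)) hfin,
    ← volume_segments r hu, ← volume_segments r hv, ← volume_segments r hw, discArea]
  have h1 := measureReal_union_le (μ := volume) (segments r u ∪ segments r v) (segments r w)
  have h2 := measureReal_union_le (μ := volume) (segments r u) (segments r v)
  linarith

theorem disjoint_ball_inter_voronoi_segments {r a b : ℝ} {v : Plane} (hv : v ∈ lattice a b) :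
    Disjoint (Metric.ball 0 r ∩ voronoi a b) (segments r v) := by
  rw [Set.disjoint_left]
  rintro x ⟨-, hx⟩ ⟨-, hx'⟩
  exact absurd (abs_inner_le_of_mem_voronoi hx hv) (not_le.2 hx')

theorem cellVolume_le_of_disjoint {r a b : ℝ} {v w : Plane} (hv : v ∈ lattice a b)
    (hw : w ∈ lattice a b) (hv0 : v ≠ 0) (hw0 : w ≠ 0)
    (h : Disjoint (segments r v) (segments r w)) :
    cellVolume r a b ≤ discArea r - segmentArea r (‖v‖ ^ 2) - segmentArea r (‖w‖ ^ 2) := by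
  rw [← volume_ball_sdiff_segments₂ hv0 hw0 h]
  exact measureReal_mono (subset_sdiff.2 ⟨inter_subset_left,
    (disjoint_ball_inter_voronoi_segments hv).union_right
      (disjoint_ball_inter_voronoi_segments hw)⟩)
    (measure_ne_top_of_subset sdiff_subset (volume_ball_ne_top r))

theorem det_basis {b : ℝ} (hb : 0 < b) (a : ℝ) :
    (basisFst b 0 * basisSnd a b 1 - basisFst b 1 * basisSnd a b 0) ^ 2 = 1 := by
  have hs : √b ≠ 0 := (Real.sqrt_pos.2 hb).ne'
  rw [basisFst_zero, basisFst_one, basisSnd_zero, basisSnd_one]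
  field_simp
  simp

/-- The disc of radius `r` minus the segments beyond the bisectors of `±(1/√b, 0)` and
`±(a/√b, √b)`, which are disjoint for `r` as stated, bounds the area of the ball in the torus. -/
theorem cellVolume_le₂ {r a b : ℝ} (hr : 0 ≤ r) (hb : 0 < b) (ha : |a| ≤ 1)
    (hab : |a| ≤ a ^ 2 + b ^ 2)
    (hR : 4 * r ^ 2 ≤ (a ^ 2 + b ^ 2) * (1 + a ^ 2 + b ^ 2 - 2 * |a|) / b ^ 3) :
    cellVolume r a b
      ≤ discArea r - segmentArea r (1 / b) - segmentArea r ((a ^ 2 + b ^ 2) / b) := by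
  have hv := norm_sq_basisFst hb
  have hw := norm_sq_basisSnd a hb
  have hd : Disjoint (segments r (basisFst b)) (segments r (basisSnd a b)) := by
    refine disjoint_segments hr (det_basis hb a) ?_ ?_ ?_ <;>
      rw [inner_basisFst_basisSnd a hb, abs_div, abs_of_pos hb]
    · rw [hv]
      gcongr
    · rw [hw]
      gcongr
    · rw [hv, hw]
      convert hR using 1
      field_simp
      ring
  rw [← hv, ← hw]
  refine cellVolume_le_of_disjoint (basisFst_mem_lattice a b) (basisSnd_mem_lattice a b)
    (ne_zero_of_norm_sq_pos ?_) (ne_zero_of_norm_sq_pos ?_) hd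
  · rw [hv]
    positivity
  · rw [hw]
    positivity

/-- Up to the circumradius `R` of the Delaunay triangle, the six segments are disjoint; `hR` says
`4r² ≤ 4R²`. -/
theorem cellVolume_le₃ {r a b : ℝ} (hr : 0 ≤ r) (hb : 0 < b) (ha : 0 ≤ a) (ha1 : a ≤ 1)
    (hab : a ≤ a ^ 2 + b ^ 2)
    (hR : 4 * r ^ 2 ≤ (a ^ 2 + b ^ 2) * ((1 - a) ^ 2 + b ^ 2) / b ^ 3) :
    cellVolume r a b ≤ discArea r - segmentArea r (1 / b) - segmentArea r ((a ^ 2 + b ^ 2) / b)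
      - segmentArea r (((1 - a) ^ 2 + b ^ 2) / b) := by
  have hu := norm_sq_basisFst hb
  have hv := norm_sq_basisSnd a hb
  have hw := norm_sq_basisSnd_sub_basisFst a hb
  have huv := inner_basisFst_basisSnd a hb
  have huw : inner ℝ (basisFst b) (basisSnd a b - basisFst b) = -((1 - a) / b) := by
    rw [inner_sub_right, huv, real_inner_self_eq_norm_sq, hu]
    ring
  have hvw : inner ℝ (basisSnd a b) (basisSnd a b - basisFst b) = (a ^ 2 + b ^ 2 - a) / b := by
    rw [inner_sub_right, real_inner_self_eq_norm_sq, hv, real_inner_comm, huv]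
    ring
  have hdet := det_basis hb a
  have e0 : (basisSnd a b - basisFst b) 0 = basisSnd a b 0 - basisFst b 0 := rfl
  have e1 : (basisSnd a b - basisFst b) 1 = basisSnd a b 1 - basisFst b 1 := rfl
  have h12 : Disjoint (segments r (basisFst b)) (segments r (basisSnd a b)) := by
    refine disjoint_segments hr hdet ?_ ?_ ?_ <;>
      rw [huv, abs_of_nonneg (by positivity)]
    · rw [hu]
      gcongr
    · rw [hv]
      gcongr
    · rw [hu, hv]
      convert hR using 1
      field_simp
      ring
  have h13 : Disjoint (segments r (basisFst b)) (segments r (basisSnd a b - basisFst b)) := by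
    refine disjoint_segments hr (by rw [e0, e1]; linear_combination hdet) ?_ ?_ ?_ <;>
      rw [huw, abs_neg, abs_of_nonneg (div_nonneg (by linarith) hb.le)]
    · rw [hu]
      gcongr
      linarith
    · rw [hw]
      gcongr
      nlinarith
    · rw [hu, hw]
      convert hR using 1
      field_simp
      ring
  have h23 : Disjoint (segments r (basisSnd a b)) (segments r (basisSnd a b - basisFst b)) := by
    refine disjoint_segments hr (by rw [e0, e1]; linear_combination hdet) ?_ ?_ ?_ <;>
      rw [hvw, abs_of_nonneg (div_nonneg (by linarith) hb.le)]
    · rw [hv]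
      gcongr
      linarith
    · rw [hw]
      gcongr
      nlinarith
    · rw [hv, hw]
      convert hR using 1
      field_simp
      ring
  have hne1 : basisFst b ≠ 0 := ne_zero_of_norm_sq_pos (by rw [hu]; positivity)
  have hne2 : basisSnd a b ≠ 0 := ne_zero_of_norm_sq_pos (by rw [hv]; positivity)
  have hne3 : basisSnd a b - basisFst b ≠ 0 := ne_zero_of_norm_sq_pos (by rw [hw]; positivity)
  rw [← hu, ← hv, ← hw, ← volume_ball_sdiff_segments₃ hne1 hne2 hne3 h12 h13 h23]
  exact measureReal_mono (subset_sdiff.2 ⟨inter_subset_left,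
    ((disjoint_ball_inter_voronoi_segments (basisFst_mem_lattice a b)).union_right
      (disjoint_ball_inter_voronoi_segments (basisSnd_mem_lattice a b))).union_right
      (disjoint_ball_inter_voronoi_segments
        (sub_mem (basisSnd_mem_lattice a b) (basisFst_mem_lattice a b)))⟩)
    (measure_ne_top_of_subset sdiff_subset (volume_ball_ne_top r))

/-- For a reduced lattice the six bisectors bound the whole Voronoi cell. -/
theorem le_cellVolume₃ {a b : ℝ} (r : ℝ) (hb : 0 < b) (ha : 0 ≤ a) (ha1 : a ≤ 1)
    (hab : a ≤ a ^ 2 + b ^ 2) :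
    discArea r - segmentArea r (1 / b) - segmentArea r ((a ^ 2 + b ^ 2) / b)
      - segmentArea r (((1 - a) ^ 2 + b ^ 2) / b) ≤ cellVolume r a b := by
  have hu := norm_sq_basisFst hb
  have hv := norm_sq_basisSnd a hb
  have hw := norm_sq_basisSnd_sub_basisFst a hb
  have hne1 : basisFst b ≠ 0 := ne_zero_of_norm_sq_pos (by rw [hu]; positivity)
  have hne2 : basisSnd a b ≠ 0 := ne_zero_of_norm_sq_pos (by rw [hv]; positivity)
  have hne3 : basisSnd a b - basisFst b ≠ 0 := ne_zero_of_norm_sq_pos (by rw [hw]; positivity)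
  have h := le_volume_ball_sdiff_segments₃ (r := r) hne1 hne2 hne3
  rw [hu, hv, hw] at h
  refine h.trans (measureReal_mono ?_
    (measure_ne_top_of_subset inter_subset_left (volume_ball_ne_top r)))
  rintro x ⟨hx, hx'⟩
  refine ⟨hx, ?_⟩
  simp only [segments, mem_union, mem_ofPred_eq, not_or, not_and, not_lt] at hx'
  obtain ⟨⟨h1, h2⟩, h3⟩ := hx'
  exact mem_voronoi_of_abs_inner_le hb ha ha1 hab (by rw [← hu]; exact h1 hx)
    (by rw [← hv]; exact h2 hx) (by rw [← hw]; exact h3 hx)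

theorem rectangle_subset_voronoi {b : ℝ} (hb : 0 < b) : rectangle b ⊆ voronoi 0 b := by
  rintro x ⟨⟨h1, h2⟩, ⟨h3, h4⟩⟩
  have hs : 0 < √b := Real.sqrt_pos.2 hb
  have hss : √b * √b = b := Real.mul_self_sqrt hb.le
  have e1 : inner ℝ x (basisFst b) = x 0 * √b / b := by
    rw [inner_eq_coords, basisFst_zero, basisFst_one]
    field_simp
    linear_combination (-x 0) * hss
  have e2 : inner ℝ x (basisSnd 0 b) = x 1 / √b * b := by
    rw [inner_eq_coords, basisSnd_zero, basisSnd_one]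
    field_simp
    linear_combination x 1 * hss
  generalize x 0 * √b = s at *
  generalize x 1 / √b = t at *
  have h1' : |inner ℝ x (basisFst b)| ≤ 1 / b / 2 := by
    rw [e1, abs_div, abs_of_pos hb, div_right_comm]
    gcongr
    exact abs_le.2 ⟨by linarith, h4.le⟩
  have h2' : |inner ℝ x (basisSnd 0 b)| ≤ (0 ^ 2 + b ^ 2) / b / 2 := by
    rw [e2, abs_mul, abs_of_pos hb]
    have : |t| ≤ 1 / 2 := abs_le.2 ⟨by linarith, h2.le⟩
    calc |t| * b ≤ 1 / 2 * b := by gcongr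
      _ = _ := by field_simp; ring
  refine mem_voronoi_of_abs_inner_le hb le_rfl zero_le_one (by positivity) h1' h2' ?_
  rw [inner_sub_right]
  refine (abs_sub _ _).trans ((add_le_add h2' h1').trans (le_of_eq ?_))
  field_simp
  ring

/-- Among the lattices with a fixed `b`, the rectangular one has the smallest balls: its Voronoi
cell is a fundamental domain for all of them. -/
theorem cellVolume_zero_le (r a : ℝ) {b : ℝ} (hb : 0 < b) :
    cellVolume r 0 b ≤ cellVolume r a b := by
  set φ : ℝ → ℝ≥0∞ := (Iio r).indicator 1 with hφ
  have hφm : Measurable φ := measurable_one.indicator measurableSet_Iio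
  have key : ∀ a, ∫⁻ x in voronoi a b, φ ‖x‖ = volume (Metric.ball 0 r ∩ voronoi a b) := by
    intro a
    have : (fun x : Plane => φ ‖x‖) = (Metric.ball (0 : Plane) r).indicator 1 := by
      funext x
      by_cases h : ‖x‖ < r <;> simp [hφ, h]
    rw [this, lintegral_indicator_one measurableSet_ball, Measure.restrict_apply measurableSet_ball]
  have hanti : ∀ s t : ℝ, s ≤ t → φ t ≤ φ s := by
    intro s t hst
    simp only [hφ, indicator_apply, mem_Iio, Pi.one_apply]
    split_ifs with h1 h2
    · exact le_rfl
    · exact absurd (hst.trans_lt h1) h2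
    · exact zero_le_one
    · exact le_rfl
  refine ENNReal.toReal_mono
    (measure_ne_top_of_subset inter_subset_left (volume_ball_ne_top r)) ?_
  rw [← key, ← key, ← lintegral_norm_torusMeasure a hb hφm, ← lintegral_norm_torusMeasure 0 hb hφm]
  refine (lintegral_torusMeasure 0 hb (isAddFundamentalDomain_rectangle 0 hb)
    (hφm.comp (measurable_norm_torus 0 b))).trans_le (le_of_le_of_eq ?_
    (lintegral_torusMeasure a hb (isAddFundamentalDomain_rectangle a hb)
    (hφm.comp (measurable_norm_torus a b))).symm)
  refine lintegral_mono_ae ?_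
  refine (ae_restrict_iff'₀ (isAddFundamentalDomain_rectangle a hb).nullMeasurableSet).2 ?_
  refine Eventually.of_forall fun x hx => hanti _ _ ?_
  exact QuotientAddGroup.norm_mk_le_norm.trans_eq
    (norm_mk_eq_of_mem_voronoi (rectangle_subset_voronoi hb hx)).symm

/-! ### Comparison of ball areas with the equilateral and the square torus -/

theorem hasDerivAt_segmentArea_sndSq {r : ℝ} (hr : 0 ≤ r) (a : ℝ) {b : ℝ} (hb : 0 < b) :
    HasDerivAt (fun a => segmentArea r ((a ^ 2 + b ^ 2) / b))
      (-√(r ^ 2 / ((a ^ 2 + b ^ 2) / b) - 1 / 4) * (2 * a / b)) a := by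
  have h1 : HasDerivAt (fun a : ℝ => (a ^ 2 + b ^ 2) / b) (2 * a / b) a := by
    simpa using ((hasDerivAt_pow 2 a).add_const (b ^ 2)).div_const b
  exact (hasDerivAt_segmentArea hr (by positivity)).comp a h1

/-- Below the circumradius, shearing the lattice towards `a = 1/2` decreases the cut off area. -/
theorem segmentArea_add_antitoneOn {r b a₀ : ℝ} (hr : 0 ≤ r) (hb : 0 < b) (ha₀ : 0 ≤ a₀)
    (hR : ∀ a ∈ Icc a₀ (1 / 2),
      4 * r ^ 2 ≤ (a ^ 2 + b ^ 2) * ((1 - a) ^ 2 + b ^ 2) / b ^ 3) :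
    AntitoneOn (fun a => segmentArea r ((a ^ 2 + b ^ 2) / b)
      + segmentArea r (((1 - a) ^ 2 + b ^ 2) / b)) (Icc a₀ (1 / 2)) := by
  have hd : ∀ a, HasDerivAt (fun a => segmentArea r ((a ^ 2 + b ^ 2) / b)
      + segmentArea r (((1 - a) ^ 2 + b ^ 2) / b))
      (-√(r ^ 2 / ((a ^ 2 + b ^ 2) / b) - 1 / 4) * (2 * a / b)
        + -√(r ^ 2 / (((1 - a) ^ 2 + b ^ 2) / b) - 1 / 4) * (2 * (1 - a) / b) * (-1)) a := by
    intro a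
    refine (hasDerivAt_segmentArea_sndSq hr a hb).add ?_
    exact (hasDerivAt_segmentArea_sndSq hr (1 - a) hb).comp a ((hasDerivAt_id a).const_sub 1)
  refine antitoneOn_of_deriv_nonpos (convex_Icc _ _)
    (fun a _ => (hd a).continuousAt.continuousWithinAt)
    (fun a _ => (hd a).differentiableAt.differentiableWithinAt) fun a ha => ?_
  rw [interior_Icc] at ha
  have ha0 : 0 ≤ a := ha₀.trans ha.1.le
  have ha1 : a < 1 / 2 := ha.2
  rw [(hd a).deriv]
  have hB : 0 < a ^ 2 + b ^ 2 := by positivity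
  have hC : 0 < (1 - a) ^ 2 + b ^ 2 := by positivity
  have key : (1 - a) * √(r ^ 2 / (((1 - a) ^ 2 + b ^ 2) / b) - 1 / 4)
      ≤ a * √(r ^ 2 / ((a ^ 2 + b ^ 2) / b) - 1 / 4) := by
    rw [← Real.sqrt_sq (by linarith : 0 ≤ 1 - a), ← Real.sqrt_mul (sq_nonneg _)]
    conv_rhs => rw [← Real.sqrt_sq ha0, ← Real.sqrt_mul (sq_nonneg _)]
    rw [Real.sqrt_sq (by linarith : 0 ≤ 1 - a), Real.sqrt_sq ha0]
    refine Real.sqrt_le_sqrt ?_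
    have h := hR a (Ioo_subset_Icc_self ha)
    rw [le_div_iff₀ (by positivity)] at h
    have e : a ^ 2 * (r ^ 2 / ((a ^ 2 + b ^ 2) / b) - 1 / 4)
        - (1 - a) ^ 2 * (r ^ 2 / (((1 - a) ^ 2 + b ^ 2) / b) - 1 / 4)
        = (1 - 2 * a) * ((a ^ 2 + b ^ 2) * ((1 - a) ^ 2 + b ^ 2) - 4 * r ^ 2 * b ^ 3)
          / (4 * ((a ^ 2 + b ^ 2) * ((1 - a) ^ 2 + b ^ 2))) := by
      field_simp
      ring
    have h2 : 0 ≤ (1 - 2 * a) * ((a ^ 2 + b ^ 2) * ((1 - a) ^ 2 + b ^ 2) - 4 * r ^ 2 * b ^ 3)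
          / (4 * ((a ^ 2 + b ^ 2) * ((1 - a) ^ 2 + b ^ 2))) := by
      refine div_nonneg (mul_nonneg (by linarith) (by linarith)) (by positivity)
    linarith
  have e : -√(r ^ 2 / ((a ^ 2 + b ^ 2) / b) - 1 / 4) * (2 * a / b)
        + -√(r ^ 2 / (((1 - a) ^ 2 + b ^ 2) / b) - 1 / 4) * (2 * (1 - a) / b) * (-1)
      = 2 / b * ((1 - a) * √(r ^ 2 / (((1 - a) ^ 2 + b ^ 2) / b) - 1 / 4)
        - a * √(r ^ 2 / ((a ^ 2 + b ^ 2) / b) - 1 / 4)) := by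
    field_simp
    ring
  rw [e]
  exact mul_nonpos_of_nonneg_of_nonpos (by positivity) (by linarith)

/-- Below the circumradius of the equilateral torus, the cut off area of the isosceles tori
`a = 1/2` strictly increases with `b ≥ √3/2`, as soon as the disc reaches the nearest bisectors. -/
theorem segmentArea_isosceles_strictMonoOn {r : ℝ} (hr : 0 ≤ r) (h1 : 2 * √3 / 3 < 4 * r ^ 2)
    (h2 : 4 * r ^ 2 ≤ 8 * √3 / 9) :
    StrictMonoOn (fun b => segmentArea r (1 / b) + 2 * segmentArea r ((1 / 4 + b ^ 2) / b))
      (Ici (√3 / 2)) := by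
  have h3 : √3 ^ 2 = 3 := Real.sq_sqrt (by norm_num)
  have h30 : 0 < √3 := by positivity
  have hd : ∀ b ∈ Ici (√3 / 2), HasDerivAt
      (fun b => segmentArea r (1 / b) + 2 * segmentArea r ((1 / 4 + b ^ 2) / b))
      (-√(r ^ 2 / (1 / b) - 1 / 4) * (-1 / b ^ 2)
        + 2 * (-√(r ^ 2 / ((1 / 4 + b ^ 2) / b) - 1 / 4) * (1 - 1 / (4 * b ^ 2)))) b := by
    intro b hb
    have hb0 : 0 < b := lt_of_lt_of_le (by positivity) hb
    have e1 : HasDerivAt (fun b : ℝ => 1 / b) (-1 / b ^ 2) b := by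
      simpa [neg_div] using hasDerivAt_inv hb0.ne'
    have e2 : HasDerivAt (fun b : ℝ => (1 / 4 + b ^ 2) / b) (1 - 1 / (4 * b ^ 2)) b := by
      have := ((hasDerivAt_pow 2 b).const_add (1 / 4)).div (hasDerivAt_id b) hb0.ne'
      refine this.congr_deriv ?_
      simp only [id]
      field_simp
      push_cast
      ring
    exact ((hasDerivAt_segmentArea hr (by positivity)).comp b e1).add
      (((hasDerivAt_segmentArea hr (by positivity)).comp b e2).const_mul 2)
  refine strictMonoOn_of_deriv_pos (convex_Ici _)
    (fun b hb => (hd b hb).continuousAt.continuousWithinAt) fun b hb => ?_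
  rw [interior_Ici] at hb
  have hb' : √3 / 2 < b := hb
  have hb0 : 0 < b := lt_trans (by positivity) hb'
  rw [(hd b hb'.le).deriv]
  have hq : 3 / 4 < b ^ 2 := by nlinarith
  have hA : 0 < r ^ 2 / (1 / b) - 1 / 4 := by
    rw [div_div_eq_mul_div, div_one]
    nlinarith
  have hRb : 4 * r ^ 2 * b ^ 3 < (b ^ 2 + 1 / 4) ^ 2 := by
    have e : 9 * (b ^ 2 + 1 / 4) ^ 2 - 8 * √3 * b ^ 3
        = (b - √3 / 2) ^ 2 * (9 * b ^ 2 + √3 * b + 3 / 4) := by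
      linear_combination (-(5 / 4) * b ^ 2 - b * √3 / 4 - 3 / 16) * h3
    have : 0 < (b - √3 / 2) ^ 2 * (9 * b ^ 2 + √3 * b + 3 / 4) :=
      mul_pos (pow_pos (by linarith) 2) (by positivity)
    have hb3 : 0 < b ^ 3 := by positivity
    nlinarith
  have key : 2 * (b ^ 2 - 1 / 4) * √(r ^ 2 / ((1 / 4 + b ^ 2) / b) - 1 / 4)
      < √(r ^ 2 / (1 / b) - 1 / 4) := by
    have h0 : 0 ≤ 2 * (b ^ 2 - 1 / 4) := by linarith
    have e0 : 2 * (b ^ 2 - 1 / 4) * √(r ^ 2 / ((1 / 4 + b ^ 2) / b) - 1 / 4)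
        = √((2 * (b ^ 2 - 1 / 4)) ^ 2 * (r ^ 2 / ((1 / 4 + b ^ 2) / b) - 1 / 4)) := by
      rw [Real.sqrt_mul (sq_nonneg _), Real.sqrt_sq h0]
    rw [e0, Real.sqrt_lt_sqrt_iff_of_pos hA]
    have e : (r ^ 2 / (1 / b) - 1 / 4)
        - (2 * (b ^ 2 - 1 / 4)) ^ 2 * (r ^ 2 / ((1 / 4 + b ^ 2) / b) - 1 / 4)
        = (b ^ 2 - 3 / 4) * ((b ^ 2 + 1 / 4) ^ 2 - 4 * r ^ 2 * b ^ 3) / (b ^ 2 + 1 / 4) := by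
      field_simp
      ring
    have : 0 < (b ^ 2 - 3 / 4) * ((b ^ 2 + 1 / 4) ^ 2 - 4 * r ^ 2 * b ^ 3) / (b ^ 2 + 1 / 4) :=
      div_pos (mul_pos (by linarith) (by linarith)) (by positivity)
    linarith
  have e : -√(r ^ 2 / (1 / b) - 1 / 4) * (-1 / b ^ 2)
        + 2 * (-√(r ^ 2 / ((1 / 4 + b ^ 2) / b) - 1 / 4) * (1 - 1 / (4 * b ^ 2)))
      = 1 / b ^ 2 * (√(r ^ 2 / (1 / b) - 1 / 4)
        - 2 * (b ^ 2 - 1 / 4) * √(r ^ 2 / ((1 / 4 + b ^ 2) / b) - 1 / 4)) := by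
    field_simp
    ring
  rw [e]
  exact mul_pos (by positivity) (by linarith)

/-- The right-hand side is `4R²` for the circumradius `R` of the Delaunay triangle, the left-hand
side its value for the equilateral lattice, which is the smallest. -/
theorem four_mul_sq_circumradius_ge {a b : ℝ} (hb : 0 < b) (hb' : 1 / 4 ≤ b ^ 2) :
    8 * √3 / 9 ≤ (a ^ 2 + b ^ 2) * ((1 - a) ^ 2 + b ^ 2) / b ^ 3 := by
  have h3 : √3 ^ 2 = 3 := Real.sq_sqrt (by norm_num)
  rw [le_div_iff₀ (by positivity)]
  have e1 : (b ^ 2 + 1 / 4) ^ 2 ≤ (a ^ 2 + b ^ 2) * ((1 - a) ^ 2 + b ^ 2) := by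
    have : (a ^ 2 + b ^ 2) * ((1 - a) ^ 2 + b ^ 2) - (b ^ 2 + 1 / 4) ^ 2
        = (a - 1 / 2) ^ 2 * (2 * (b ^ 2 - 1 / 4) + (a - 1 / 2) ^ 2) := by ring
    have : 0 ≤ (a - 1 / 2) ^ 2 * (2 * (b ^ 2 - 1 / 4) + (a - 1 / 2) ^ 2) :=
      mul_nonneg (sq_nonneg _) (by nlinarith [sq_nonneg (a - 1 / 2)])
    linarith
  have e2 : 9 * (b ^ 2 + 1 / 4) ^ 2 - 8 * √3 * b ^ 3
      = (b - √3 / 2) ^ 2 * (9 * b ^ 2 + √3 * b + 3 / 4) := by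
    linear_combination (-(5 / 4) * b ^ 2 - b * √3 / 4 - 3 / 16) * h3
  have : 0 ≤ (b - √3 / 2) ^ 2 * (9 * b ^ 2 + √3 * b + 3 / 4) := by positivity
  linarith

theorem voronoi_equilateral_subset :
    voronoi (1 / 2) (√3 / 2) ⊆ Metric.closedBall 0 √(2 * √3 / 9) := by
  intro x hx
  have hb : 0 < √3 / 2 := by positivity
  have h3 : √3 ^ 2 = 3 := Real.sq_sqrt (by norm_num)
  rw [mem_closedBall_zero_iff]
  refine Real.le_sqrt_of_sq_le ?_
  set v := basisFst (√3 / 2)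
  set w := basisSnd (1 / 2) (√3 / 2)
  have hA : ‖v‖ ^ 2 = 2 * √3 / 3 := by
    rw [norm_sq_basisFst hb]
    field_simp
    linear_combination -h3
  have hB : ‖w‖ ^ 2 = 2 * √3 / 3 := by
    rw [norm_sq_basisSnd _ hb]
    field_simp
    linear_combination -h3
  have hc : inner ℝ v w = √3 / 3 := by
    rw [inner_basisFst_basisSnd _ hb]
    field_simp
    linear_combination -h3
  have hC : ‖w - v‖ ^ 2 = 2 * √3 / 3 := by
    rw [norm_sub_sq_real, real_inner_comm, hA, hB, hc]
    ring
  have h1 := abs_inner_le_of_mem_voronoi hx (basisFst_mem_lattice (1 / 2) (√3 / 2))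
  have h2 := abs_inner_le_of_mem_voronoi hx (basisSnd_mem_lattice (1 / 2) (√3 / 2))
  have h4 := abs_inner_le_of_mem_voronoi hx (sub_mem (basisSnd_mem_lattice (1 / 2) (√3 / 2))
    (basisFst_mem_lattice (1 / 2) (√3 / 2)))
  rw [hA] at h1
  rw [hB] at h2
  rw [hC, inner_sub_right] at h4
  have hgram : ‖x‖ ^ 2 = 2 * √3 / 3 * (inner ℝ x v ^ 2 - inner ℝ x v * inner ℝ x w
      + inner ℝ x w ^ 2) := by
    have hdet := det_basis hb (1 / 2)
    have e : ‖x‖ ^ 2 = ‖w‖ ^ 2 * inner ℝ x v ^ 2 - 2 * inner ℝ v w * (inner ℝ x v * inner ℝ x w)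
        + ‖v‖ ^ 2 * inner ℝ x w ^ 2 := by
      simp only [inner_eq_coords, norm_sq_eq_coords]
      linear_combination (-(x 0 ^ 2 + x 1 ^ 2)) * hdet
    rw [e, hA, hB, hc]
    ring
  have key : ∀ X Y k : ℝ, |X| ≤ k → |Y| ≤ k → |Y - X| ≤ k → X ^ 2 - X * Y + Y ^ 2 ≤ k ^ 2 := by
    intro X Y k hX hY hXY
    have hk : 0 ≤ k := (abs_nonneg _).trans hX
    have s1 := sq_le_sq' (abs_le.1 hX).1 (abs_le.1 hX).2
    have s2 := sq_le_sq' (abs_le.1 hY).1 (abs_le.1 hY).2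
    have s3 := sq_le_sq' (abs_le.1 hXY).1 (abs_le.1 hXY).2
    -- depending on the signs, the form is at most `X²`, `Y²` or `(Y - X)²`
    rcases le_total 0 (X * Y) with h | h
    · rcases le_total (X * (Y - X)) 0 with h' | h'
      · nlinarith
      · nlinarith
    · nlinarith
  have := key _ _ _ h1 h2 h4
  rw [hgram]
  calc 2 * √3 / 3 * (inner ℝ x v ^ 2 - inner ℝ x v * inner ℝ x w + inner ℝ x w ^ 2)
      ≤ 2 * √3 / 3 * (2 * √3 / 3 / 2) ^ 2 := by gcongr
    _ = 2 * √3 / 9 := by linear_combination (2 * √3 / 27) * h3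

theorem sqrt_three_div_two_le_of_mem_parameterDomain {p : ℝ × ℝ} (hp : p ∈ parameterDomain) :
    √3 / 2 ≤ p.2 := by
  obtain ⟨hb, ⟨ha0, ha1⟩, hab⟩ := hp
  have h3 : √3 ^ 2 = 3 := Real.sq_sqrt (by norm_num)
  refine le_of_sq_le_sq ?_ hb.le
  nlinarith

theorem cellVolume_isosceles_eq {r b : ℝ} (hr : 0 ≤ r) (hb : √3 / 2 ≤ b)
    (h2 : 4 * r ^ 2 ≤ 8 * √3 / 9) :
    cellVolume r (1 / 2) b = discArea r - (segmentArea r (1 / b)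
      + 2 * segmentArea r ((1 / 4 + b ^ 2) / b)) := by
  have hb0 : 0 < b := lt_of_lt_of_le (by positivity) hb
  have h3 : √3 ^ 2 = 3 := Real.sq_sqrt (by norm_num)
  have hq : 3 / 4 ≤ b ^ 2 := by nlinarith [Real.sqrt_nonneg 3]
  have u := cellVolume_le₃ (a := 1 / 2) hr hb0 (by norm_num) (by norm_num) (by linarith)
    (h2.trans (four_mul_sq_circumradius_ge hb0 (by linarith)))
  have l := le_cellVolume₃ (a := 1 / 2) r hb0 (by norm_num) (by norm_num) (by linarith)
  norm_num at u l ⊢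
  linarith

theorem cellVolume_le_isosceles {r : ℝ} (hr : 0 ≤ r) {p : ℝ × ℝ} (hp : p ∈ parameterDomain)
    (h2 : 4 * r ^ 2 ≤ 8 * √3 / 9) :
    cellVolume r p.1 p.2 ≤ cellVolume r (1 / 2) p.2 := by
  have hb' := sqrt_three_div_two_le_of_mem_parameterDomain hp
  obtain ⟨a, b⟩ := p
  obtain ⟨hb, ⟨ha0, ha1⟩, hab⟩ := hp
  simp only at *
  have h3 : √3 ^ 2 = 3 := Real.sq_sqrt (by norm_num)
  have hq : 3 / 4 ≤ b ^ 2 := by nlinarith [Real.sqrt_nonneg 3]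
  have hR : ∀ a, 4 * r ^ 2 ≤ (a ^ 2 + b ^ 2) * ((1 - a) ^ 2 + b ^ 2) / b ^ 3 :=
    fun a => h2.trans (four_mul_sq_circumradius_ge hb (by linarith))
  have u := cellVolume_le₃ hr hb ha0 (by linarith) (by linarith) (hR a)
  have m := segmentArea_add_antitoneOn hr hb ha0 (fun a _ => hR a)
    (left_mem_Icc.2 ha1) (right_mem_Icc.2 ha1) ha1
  rw [cellVolume_isosceles_eq hr hb' h2]
  norm_num at u m ⊢
  linarith

theorem equilateral_mem : equilateral ∈ parameterDomain := by
  have h3 : √3 ^ 2 = 3 := Real.sq_sqrt (by norm_num)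
  refine ⟨?_, ⟨?_, ?_⟩, ?_⟩
  · change 0 < √3 / 2
    positivity
  · change (0 : ℝ) ≤ 1 / 2
    norm_num
  · exact le_rfl
  · change (1 : ℝ) ≤ (1 / 2) ^ 2 + (√3 / 2) ^ 2
    nlinarith

theorem eq_equilateral {p : ℝ × ℝ} (hp : p ∈ parameterDomain) (h : p.2 = √3 / 2) :
    p = equilateral := by
  obtain ⟨hb, ⟨ha0, ha1⟩, hab⟩ := hp
  have h3 : √3 ^ 2 = 3 := Real.sq_sqrt (by norm_num)
  rw [h] at hab
  refine Prod.ext ?_ h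
  change p.1 = 1 / 2
  nlinarith

/-- Strict maximality of the balls of the equilateral torus, for intermediate radii. -/
theorem cellVolume_lt_equilateral {r : ℝ} (hr : 0 ≤ r) (h1 : 2 * √3 / 3 < 4 * r ^ 2)
    (h2 : 4 * r ^ 2 ≤ 8 * √3 / 9) {p : ℝ × ℝ} (hp : p ∈ parameterDomain) (hne : p ≠ equilateral) :
    cellVolume r p.1 p.2 < cellVolume r equilateral.1 equilateral.2 := by
  have hb := sqrt_three_div_two_le_of_mem_parameterDomain hp
  have hb' : √3 / 2 < p.2 := lt_of_le_of_ne hb fun h => hne (eq_equilateral hp h.symm)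
  refine (cellVolume_le_isosceles hr hp h2).trans_lt ?_
  change _ < cellVolume r (1 / 2) (√3 / 2)
  rw [cellVolume_isosceles_eq hr hb h2, cellVolume_isosceles_eq hr le_rfl h2]
  have := segmentArea_isosceles_strictMonoOn hr h1 h2 (mem_Ici.2 le_rfl) hb hb'
  simp only at this
  linarith

/-- Balls of any radius are largest in the equilateral torus. -/
theorem cellVolume_le_equilateral {r : ℝ} (hr : 0 ≤ r) {p : ℝ × ℝ} (hp : p ∈ parameterDomain) :
    cellVolume r p.1 p.2 ≤ cellVolume r equilateral.1 equilateral.2 := by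
  have hb := sqrt_three_div_two_le_of_mem_parameterDomain hp
  have h3 : √3 ^ 2 = 3 := Real.sq_sqrt (by norm_num)
  have h30 : 0 < √3 := by positivity
  rcases le_total (4 * r ^ 2) (8 * √3 / 9) with h2 | h2
  · rcases lt_or_ge (2 * √3 / 3) (4 * r ^ 2) with h1 | h1
    · by_cases hne : p = equilateral
      · rw [hne]
      · exact (cellVolume_lt_equilateral hr h1 h2 hp hne).le
    · -- the disc lies inside the cell of the equilateral lattice
      refine (cellVolume_le_isosceles hr hp h2).trans ?_
      change _ ≤ cellVolume r (1 / 2) (√3 / 2)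
      rw [cellVolume_isosceles_eq hr hb h2, cellVolume_isosceles_eq hr le_rfl h2]
      have e1 : segmentArea r (1 / (√3 / 2)) = 0 := by
        refine segmentArea_eq_zero (h1.trans (le_of_eq ?_))
        field_simp
        linarith
      have e2 : segmentArea r ((1 / 4 + (√3 / 2) ^ 2) / (√3 / 2)) = 0 := by
        refine segmentArea_eq_zero (h1.trans (le_of_eq ?_))
        field_simp
        linarith
      rw [e1, e2]
      have := segmentArea_nonneg r (1 / p.2)
      have := segmentArea_nonneg r ((1 / 4 + p.2 ^ 2) / p.2)
      linarith
  · have hr' : √(2 * √3 / 9) ≤ r := Real.sqrt_le_iff.2 ⟨hr, by linarith⟩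
    have h := cellVolume_eq_one (by positivity) voronoi_equilateral_subset hr'
    change _ ≤ cellVolume r (1 / 2) (√3 / 2)
    rw [h]
    exact cellVolume_le_one r p.1 hp.1

/-- The Voronoi cell of the square lattice is a unit square. -/
theorem voronoi_square_subset : voronoi 0 1 ⊆ Metric.closedBall 0 √(1 / 2) := by
  intro x hx
  rw [mem_closedBall_zero_iff]
  refine Real.le_sqrt_of_sq_le ?_
  have h1 := abs_inner_le_of_mem_voronoi hx (basisFst_mem_lattice 0 1)
  have h2 := abs_inner_le_of_mem_voronoi hx (basisSnd_mem_lattice 0 1)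
  rw [norm_sq_basisFst one_pos, inner_eq_coords, basisFst_zero, basisFst_one] at h1
  rw [norm_sq_basisSnd 0 one_pos, inner_eq_coords, basisSnd_zero, basisSnd_one] at h2
  norm_num at h1 h2
  rw [norm_sq_eq_coords, ← sq_abs (x 0), ← sq_abs (x 1)]
  nlinarith [abs_nonneg (x 0), abs_nonneg (x 1)]

theorem cellVolume_square_eq_one {r : ℝ} (hr : 0 ≤ r) (h : 2 ≤ 4 * r ^ 2) :
    cellVolume r 0 1 = 1 :=
  cellVolume_eq_one one_pos voronoi_square_subset (Real.sqrt_le_iff.2 ⟨hr, by linarith⟩)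

theorem le_cellVolume₂ {r : ℝ} (a : ℝ) {b : ℝ} (hb : 0 < b) (h : 4 * r ^ 2 ≤ 2) :
    discArea r - segmentArea r (1 / b) - segmentArea r b ≤ cellVolume r a b := by
  refine le_trans ?_ (cellVolume_zero_le r a hb)
  have l := le_cellVolume₃ (a := 0) r hb le_rfl zero_le_one (by positivity)
  have e : segmentArea r (((1 - 0) ^ 2 + b ^ 2) / b) = 0 := by
    refine segmentArea_eq_zero (h.trans ?_)
    rw [le_div_iff₀ hb]
    nlinarith [sq_nonneg (b - 1)]
  have e2 : ((0 : ℝ) ^ 2 + b ^ 2) / b = b := by field_simp; ring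
  rw [e, e2] at l
  linarith

theorem cellVolume_rectangular_eq {r b : ℝ} (hr : 0 ≤ r) (hb : 0 < b) (h : 4 * r ^ 2 ≤ 2) :
    cellVolume r 0 b = discArea r - segmentArea r (1 / b) - segmentArea r b := by
  refine le_antisymm ?_ (le_cellVolume₂ 0 hb h)
  have u := cellVolume_le₂ (a := 0) hr hb (by simp) (by simp; positivity) (h.trans ?_)
  · have e2 : ((0 : ℝ) ^ 2 + b ^ 2) / b = b := by field_simp; ring
    rwa [e2] at u
  · rw [le_div_iff₀ (by positivity), abs_zero]
    nlinarith [sq_nonneg (b - 1), sq_nonneg b, mul_nonneg (sq_nonneg b) (sq_nonneg (b - 1))]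

theorem segmentArea_rectangular_strictMonoOn {r : ℝ} (hr : 0 ≤ r) (h1 : 1 < 4 * r ^ 2)
    (h2 : 4 * r ^ 2 ≤ 2) :
    StrictMonoOn (fun b => segmentArea r (1 / b) + segmentArea r b) (Ici 1) := by
  have hd : ∀ b ∈ Ici (1 : ℝ), HasDerivAt (fun b => segmentArea r (1 / b) + segmentArea r b)
      (-√(r ^ 2 / (1 / b) - 1 / 4) * (-1 / b ^ 2) + -√(r ^ 2 / b - 1 / 4)) b := by
    intro b hb
    have hb0 : 0 < b := lt_of_lt_of_le one_pos hb
    have e1 : HasDerivAt (fun b : ℝ => 1 / b) (-1 / b ^ 2) b := by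
      simpa [neg_div] using hasDerivAt_inv hb0.ne'
    exact ((hasDerivAt_segmentArea hr (by positivity)).comp b e1).add
      (hasDerivAt_segmentArea hr hb0)
  refine strictMonoOn_of_deriv_pos (convex_Ici _)
    (fun b hb => (hd b hb).continuousAt.continuousWithinAt) fun b hb => ?_
  rw [interior_Ici] at hb
  have hb' : 1 < b := hb
  have hb0 : 0 < b := lt_trans one_pos hb'
  rw [(hd b hb'.le).deriv]
  have hA : 0 < r ^ 2 / (1 / b) - 1 / 4 := by
    rw [div_div_eq_mul_div, div_one]
    nlinarith
  have key : b ^ 2 * √(r ^ 2 / b - 1 / 4) < √(r ^ 2 / (1 / b) - 1 / 4) := by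
    have e0 : b ^ 2 * √(r ^ 2 / b - 1 / 4) = √((b ^ 2) ^ 2 * (r ^ 2 / b - 1 / 4)) := by
      rw [Real.sqrt_mul (sq_nonneg _), Real.sqrt_sq (sq_nonneg _)]
    rw [e0, Real.sqrt_lt_sqrt_iff_of_pos hA]
    have e : (r ^ 2 / (1 / b) - 1 / 4) - (b ^ 2) ^ 2 * (r ^ 2 / b - 1 / 4)
        = (b ^ 2 - 1) * (b ^ 2 + 1 - 4 * r ^ 2 * b) / 4 := by
      field_simp
      ring
    have : 0 < (b ^ 2 - 1) * (b ^ 2 + 1 - 4 * r ^ 2 * b) / 4 := by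
      refine div_pos (mul_pos (by nlinarith) ?_) (by norm_num)
      nlinarith [pow_pos (sub_pos.2 hb') 2]
    linarith
  have e : -√(r ^ 2 / (1 / b) - 1 / 4) * (-1 / b ^ 2) + -√(r ^ 2 / b - 1 / 4)
      = 1 / b ^ 2 * (√(r ^ 2 / (1 / b) - 1 / 4) - b ^ 2 * √(r ^ 2 / b - 1 / 4)) := by
    field_simp
    ring
  rw [e]
  exact mul_pos (by positivity) (by linarith)

/-- Elongated rectangular tori have smaller balls than the square torus. -/
theorem cellVolume_rectangular_lt {r b : ℝ} (hr : 0 ≤ r) (hb : 1 < b) (h1 : 1 < 4 * r ^ 2)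
    (h2 : 4 * r ^ 2 ≤ 2) : cellVolume r 0 b < cellVolume r 0 1 := by
  rw [cellVolume_rectangular_eq hr (one_pos.trans hb) h2, cellVolume_rectangular_eq hr one_pos h2]
  have := segmentArea_rectangular_strictMonoOn hr h1 h2 (mem_Ici.2 le_rfl) (mem_Ici.2 hb.le) hb
  simp only at this
  linarith

theorem cellVolume_rectangular_le {r b : ℝ} (hr : 0 ≤ r) (hb : 1 < b) :
    cellVolume r 0 b ≤ cellVolume r 0 1 := by
  rcases le_total (4 * r ^ 2) 2 with h2 | h2
  · rcases lt_or_ge 1 (4 * r ^ 2) with h1 | h1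
    · exact (cellVolume_rectangular_lt hr hb h1 h2).le
    · rw [cellVolume_rectangular_eq hr (one_pos.trans hb) h2,
        cellVolume_rectangular_eq hr one_pos h2, div_one, segmentArea_eq_zero h1]
      have := segmentArea_nonneg r (1 / b)
      have := segmentArea_nonneg r b
      linarith
  · rw [cellVolume_square_eq_one hr h2]
    exact cellVolume_le_one r 0 (one_pos.trans hb)

/-- Sheared tori have larger balls than the square torus. -/
theorem lt_cellVolume_sheared {r a : ℝ} (hr : 0 ≤ r) (ha : 0 < a) (ha1 : a ≤ 1 / 2)
    (h1 : 1 < 4 * r ^ 2) (h2 : 4 * r ^ 2 ≤ 5 / 4) : cellVolume r 0 1 < cellVolume r a 1 := by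
  rw [cellVolume_rectangular_eq hr one_pos (by linarith)]
  refine lt_of_lt_of_le ?_ (le_cellVolume₃ r one_pos ha.le (by linarith) (by nlinarith))
  rw [segmentArea_eq_zero (A := ((1 - a) ^ 2 + 1 ^ 2) / 1) (by rw [div_one]; nlinarith)]
  have := segmentArea_lt (B := (a ^ 2 + 1 ^ 2) / 1) hr zero_le_one
    (by rw [div_one]; nlinarith [pow_pos ha 2]) h1
  linarith

/-! ### First-order behaviour of ball areas at the square torus -/

/-- A function squeezed between two functions with vanishing derivative and the same value. -/
theorem hasFDerivAt_zero_of_squeeze {E : Type*} [NormedAddCommGroup E] [NormedSpace ℝ E]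
    {L F U : E → ℝ} {x : E} (hL : HasFDerivAt L (0 : E →L[ℝ] ℝ) x)
    (hU : HasFDerivAt U (0 : E →L[ℝ] ℝ) x) (hLF : ∀ᶠ y in 𝓝 x, L y ≤ F y)
    (hFU : ∀ᶠ y in 𝓝 x, F y ≤ U y) (hx : U x ≤ L x) : HasFDerivAt F (0 : E →L[ℝ] ℝ) x := by
  rw [hasFDerivAt_iff_isLittleO] at hL hU ⊢
  simp only [zero_apply, sub_zero] at hL hU ⊢
  have h := hL.norm_left.add hU.norm_left
  refine (Asymptotics.IsBigO.of_bound 1 ?_).trans_isLittleO h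
  filter_upwards [hLF, hFU] with y h1 h2
  have h3 := hLF.self_of_nhds
  have h4 := hFU.self_of_nhds
  rw [one_mul, Real.norm_eq_abs, Real.norm_eq_abs, Real.norm_eq_abs, Real.norm_eq_abs]
  refine le_trans ?_ (le_abs_self _)
  rcases le_total 0 (F y - F x) with h | h
  · rw [abs_of_nonneg h]
    linarith [le_abs_self (U y - U x), abs_nonneg (L y - L x)]
  · rw [abs_of_nonpos h]
    linarith [neg_abs_le (L y - L x), abs_nonneg (U y - U x)]

theorem hasFDerivAt_sndSq :
    HasFDerivAt (fun p : ℝ × ℝ => (p.1 ^ 2 + p.2 ^ 2) / p.2) (ContinuousLinearMap.snd ℝ ℝ ℝ)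
      square := by
  have e : (fun p : ℝ × ℝ => (p.1 ^ 2 + p.2 ^ 2) / p.2)
      = fun p : ℝ × ℝ => p.1 * (p.1 * p.2⁻¹) + p.2 := by
    funext p
    by_cases h : p.2 = 0
    · simp [h]
    · field_simp
  rw [e]
  have hd : DifferentiableAt ℝ (fun p : ℝ × ℝ => p.1 * p.2⁻¹) square := by
    refine differentiableAt_fst.mul (differentiableAt_snd.inv ?_)
    change (1 : ℝ) ≠ 0
    norm_num
  have h := (hasFDerivAt_fst.mul hd.hasFDerivAt).add (hasFDerivAt_snd (𝕜 := ℝ) (p := square))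
  refine h.congr_fderiv ?_
  simp [square]

/-- The first-order changes of the sides `1/b` and `b` cancel. -/
theorem hasFDerivAt_rectangular_bound {r : ℝ} (hr : 0 ≤ r) (c : ℝ) {q : ℝ × ℝ → ℝ}
    (hq : HasFDerivAt q (ContinuousLinearMap.snd ℝ ℝ ℝ) square) (hq1 : q square = 1) :
    HasFDerivAt (fun p : ℝ × ℝ => c - segmentArea r (1 / p.2) - segmentArea r (q p))
      (0 : ℝ × ℝ →L[ℝ] ℝ) square := by
  have h1 : HasDerivAt (segmentArea r) (-√(r ^ 2 / 1 - 1 / 4)) 1 :=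
    hasDerivAt_segmentArea hr one_pos
  have e1 : HasDerivAt (fun b : ℝ => 1 / b) (-1) 1 := by
    simpa using hasDerivAt_inv (one_ne_zero' ℝ)
  have h2 : HasDerivAt (fun b : ℝ => segmentArea r (1 / b)) (-√(r ^ 2 / 1 - 1 / 4) * (-1))
      (square.2) :=
    HasDerivAt.comp (h₂ := segmentArea r) (h := fun b : ℝ => 1 / b) (1 : ℝ)
      (by rw [div_one (1 : ℝ)]; exact h1) e1
  have h3 := h2.comp_hasFDerivAt square (hasFDerivAt_snd (𝕜 := ℝ) (p := square))
  have h4 : HasFDerivAt (fun p => segmentArea r (q p))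
      ((-√(r ^ 2 / 1 - 1 / 4)) • ContinuousLinearMap.snd ℝ ℝ ℝ) square :=
    HasDerivAt.comp_hasFDerivAt (h₂ := segmentArea r) square (by rwa [hq1]) hq
  refine ((h3.const_sub c).sub h4).congr_fderiv ?_
  ext <;> simp

theorem hasFDerivAt_cellVolume {r : ℝ} (hr : 0 ≤ r) :
    HasFDerivAt (fun p : ℝ × ℝ => cellVolume r p.1 p.2) (0 : ℝ × ℝ →L[ℝ] ℝ) square := by
  have hsnd : HasFDerivAt (fun p : ℝ × ℝ => p.2) (ContinuousLinearMap.snd ℝ ℝ ℝ) square :=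
    hasFDerivAt_snd
  have hpos : ∀ᶠ p in 𝓝 square, 0 < p.2 :=
    (isOpen_lt continuous_const continuous_snd).mem_nhds (by change (0 : ℝ) < 1; norm_num)
  rcases lt_or_ge (4 * r ^ 2) 2 with h2 | h2
  · refine hasFDerivAt_zero_of_squeeze
      (hasFDerivAt_rectangular_bound hr (discArea r) hsnd rfl)
      (hasFDerivAt_rectangular_bound hr (discArea r) hasFDerivAt_sndSq (by simp [square])) ?_ ?_ ?_
    · filter_upwards [hpos] with p hp
      exact le_cellVolume₂ p.1 hp h2.le
    · have c1 : ∀ᶠ p : ℝ × ℝ in 𝓝 square, |p.1| < 1 :=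
        (isOpen_lt (by fun_prop) continuous_const).mem_nhds (by simp [square])
      have c2 : ∀ᶠ p : ℝ × ℝ in 𝓝 square, |p.1| < p.1 ^ 2 + p.2 ^ 2 :=
        (isOpen_lt (by fun_prop) (by fun_prop)).mem_nhds (by simp [square])
      have c3 : ∀ᶠ p : ℝ × ℝ in 𝓝 square, 4 * r ^ 2 * p.2 ^ 3
          < (p.1 ^ 2 + p.2 ^ 2) * (1 + p.1 ^ 2 + p.2 ^ 2 - 2 * |p.1|) :=
        (isOpen_lt (by fun_prop) (by fun_prop)).mem_nhds (by simp [square]; linarith)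
      filter_upwards [hpos, c1, c2, c3] with p hp h1 h3 h4
      refine cellVolume_le₂ hr hp h1.le h3.le ?_
      rw [le_div_iff₀ (by positivity)]
      exact h4.le
    · simp [square]
  · -- the disc covers the square, and shrinks to its circumscribed disc for the lower bound
    set r₀ := √(1 / 2) with hr₀
    have hr₀0 : 0 ≤ r₀ := Real.sqrt_nonneg _
    have hsq : 4 * r₀ ^ 2 = 2 := by
      rw [hr₀, Real.sq_sqrt (by norm_num)]
      norm_num
    have hle : r₀ ≤ r := Real.sqrt_le_iff.2 ⟨hr, by linarith⟩
    refine hasFDerivAt_zero_of_squeeze (U := fun _ => 1)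
      (hasFDerivAt_rectangular_bound hr₀0 (discArea r₀) hsnd rfl) (hasFDerivAt_const _ _) ?_ ?_ ?_
    · filter_upwards [hpos] with p hp
      exact (le_cellVolume₂ p.1 hp hsq.le).trans (cellVolume_mono hle _ _)
    · filter_upwards [hpos] with p hp
      exact cellVolume_le_one r p.1 hp
    · have h := cellVolume_rectangular_eq hr₀0 one_pos hsq.le
      rw [cellVolume_square_eq_one hr₀0 hsq.ge] at h
      exact h.le

/-- The closed square with side `2s` centred at the origin. -/
def centredSquare (s : ℝ) : Set Plane := {x | |x 0| ≤ s ∧ |x 1| ≤ s}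

theorem volume_centredSquare {s : ℝ} (hs : 0 ≤ s) :
    volume.real (centredSquare s) = 4 * s ^ 2 := by
  have h : centredSquare s = (MeasurableEquiv.toLp 2 (Fin 2 → ℝ)).symm ⁻¹'
      (univ.pi fun _ => Icc (-s) s) := by
    ext x
    simp only [centredSquare, mem_ofPred_eq, mem_preimage, Set.mem_pi, mem_univ, true_imp_iff,
      Fin.forall_fin_two, mem_Icc, abs_le]
    rfl
  rw [h, Measure.real,
    (EuclideanSpace.volume_preserving_symm_measurableEquiv_toLp (Fin 2)).measure_preimage
    (MeasurableSet.univ_pi fun i => measurableSet_Icc).nullMeasurableSet, volume_pi_pi]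
  simp only [Fin.prod_univ_two, Real.volume_Icc]
  rw [← ENNReal.ofReal_mul (by linarith), ENNReal.toReal_ofReal (by nlinarith)]
  ring

theorem ball_subset_centredSquare {r s : ℝ} (h : r ≤ s) :
    Metric.ball 0 r ⊆ centredSquare s := by
  intro x hx
  rw [mem_ball_zero_iff] at hx
  have h2 := norm_sq_eq_coords x
  constructor <;> refine abs_le_of_sq_le_sq ?_ ((norm_nonneg x).trans (hx.le.trans h)) <;>
    nlinarith [norm_nonneg x, sq_nonneg (x 0), sq_nonneg (x 1)]

/-- Voronoi cells of lattices near the square lattice contain almost the whole unit square. -/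
theorem centredSquare_subset_voronoi {ε a b : ℝ} (hε : ε ≤ 1 / 16) (ha : |a| ≤ ε)
    (hb : |b - 1| ≤ ε) : centredSquare ((1 - 4 * ε) / 2) ⊆ voronoi a b := by
  rintro x ⟨h0, h1⟩
  set s := (1 - 4 * ε) / 2 with hs
  have hε0 : 0 ≤ ε := (abs_nonneg a).trans ha
  have hs0 : 0 ≤ s := by linarith
  obtain ⟨hb1, hb2⟩ := abs_le.1 hb
  have hb0 : 0 < b := by linarith
  set w := √b with hw
  have hw0 : 0 < w := Real.sqrt_pos.2 hb0
  have hww : w ^ 2 = b := Real.sq_sqrt hb0.le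
  have hw1 : w ≤ 1 + ε := Real.sqrt_le_iff.2 ⟨by linarith, by nlinarith⟩
  have hw2 : 1 - ε ≤ w := Real.le_sqrt_of_sq_le (by nlinarith)
  have hsum : ∀ P Q : ℝ, 0 ≤ Q → |x 0 * P + x 1 * Q| ≤ s * (|P| + Q) := by
    intro P Q hQ
    refine (abs_add_le _ _).trans ?_
    rw [abs_mul, abs_mul, abs_of_nonneg hQ, mul_add]
    gcongr
  have g1 : |inner ℝ x (basisFst b)| ≤ 1 / b / 2 := by
    rw [inner_eq_coords, basisFst_zero, basisFst_one]
    refine (hsum _ _ le_rfl).trans ?_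
    rw [abs_of_pos (by positivity), add_zero, ← hw, ← hww, mul_one_div, div_div (1 : ℝ),
      div_le_div_iff₀ hw0 (by positivity), one_mul]
    nlinarith [mul_nonneg hs0 hw0.le]
  have g2 : |inner ℝ x (basisSnd a b)| ≤ (a ^ 2 + b ^ 2) / b / 2 := by
    rw [inner_eq_coords, basisSnd_zero, basisSnd_one]
    refine (hsum _ _ hw0.le).trans ?_
    have e1 : |a / √b| ≤ ε / w := by
      rw [abs_div, abs_of_pos hw0]
      gcongr
    have e2 : b / 2 ≤ (a ^ 2 + b ^ 2) / b / 2 := by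
      gcongr
      rw [le_div_iff₀ hb0]
      nlinarith [sq_nonneg a]
    have e3 : s * (ε / w + w) ≤ b / 2 := by
      have : s * (ε / w + w) = s * (ε + b) / w := by
        rw [← hww]
        field_simp
      rw [this, div_le_div_iff₀ hw0 two_pos]
      have : b * (1 - ε) ≤ b * w := by gcongr
      nlinarith
    exact le_trans (by gcongr) (e3.trans e2)
  have g3 : ∀ u P : ℝ, 1 - ε ≤ u → |P| = u / w →
      |x 0 * P + x 1 * w| ≤ (u ^ 2 + b ^ 2) / b / 2 := by
    intro u P hu hP
    refine (hsum _ _ hw0.le).trans ?_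
    have e : s * (|P| + w) = s * (w * (u + b)) / b := by
      rw [hP, ← hww]
      field_simp
    rw [e, div_div, mul_comm b 2, ← div_div, div_le_div_iff_of_pos_right hb0]
    have e1 : (1 - 4 * ε) * w ≤ 1 - ε := by nlinarith
    have e2 : (1 - ε) * (u + b) ≤ u ^ 2 + b ^ 2 := by nlinarith
    have e3 : (1 - 4 * ε) * w * (u + b) ≤ (1 - ε) * (u + b) := by
      refine mul_le_mul_of_nonneg_right e1 ?_
      linarith
    rw [hs]
    linarith
  have hbig : 1 / 16 ≤ b ^ 2 := by nlinarith
  rcases le_total 0 a with hna | hna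
  · rw [abs_of_nonneg hna] at ha
    refine mem_voronoi_of_abs_inner_le hb0 hna (by linarith) (by nlinarith) g1 g2 ?_
    have e0 : (basisSnd a b - basisFst b) 0 = a / w - 1 / w := rfl
    have e1 : (basisSnd a b - basisFst b) 1 = w - 0 := rfl
    rw [inner_eq_coords, e0, e1, sub_zero]
    refine g3 (1 - a) _ (by linarith) ?_
    rw [← sub_div, abs_div, abs_of_pos hw0, abs_sub_comm, abs_of_nonneg (by linarith)]
  · rw [abs_of_nonpos hna] at ha
    refine mem_voronoi_of_abs_inner_le' hb0 hna (by linarith) (by nlinarith) g1 g2 ?_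
    have e0 : (basisSnd a b + basisFst b) 0 = a / w + 1 / w := rfl
    have e1 : (basisSnd a b + basisFst b) 1 = w + 0 := rfl
    rw [inner_eq_coords, e0, e1, add_zero]
    refine g3 (1 + a) _ (by linarith) ?_
    rw [← add_div, abs_div, abs_of_pos hw0, abs_of_nonneg (by linarith), add_comm]

theorem cellVolume_sub_le {b b' : ℝ} (r a a' : ℝ) (hb : 0 < b) :
    cellVolume r a b - cellVolume r a' b' ≤ 1 - volume.real (voronoi a b ∩ voronoi a' b') := by
  have hfin : volume (voronoi a b) ≠ ∞ := by
    rw [volume_voronoi a hb]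
    exact ENNReal.one_ne_top
  have h1 : cellVolume r a b
      ≤ cellVolume r a' b' + volume.real (voronoi a b \ voronoi a' b') := by
    refine le_trans (measureReal_mono ?_ ?_) (measureReal_union_le _ _)
    · intro x hx
      by_cases h : x ∈ voronoi a' b'
      · exact Or.inl ⟨hx.1, h⟩
      · exact Or.inr ⟨hx.2, h⟩
    · exact (measure_union_lt_top
        ((measure_mono inter_subset_left).trans_lt (volume_ball_ne_top r).lt_top)
        ((measure_mono sdiff_subset).trans_lt hfin.lt_top)).ne
  have h2 := measureReal_inter_add_sdiff (μ := volume) (s := voronoi a b)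
    (measurableSet_voronoi a' b') hfin
  have h3 : volume.real (voronoi a b) = 1 := by
    rw [Measure.real, volume_voronoi a hb]
    rfl
  linarith

/-- A Lipschitz estimate at the square torus, uniform in the radius. -/
theorem abs_cellVolume_sub_square_le (r : ℝ) {p : ℝ × ℝ} (hp : ‖p - square‖ ≤ 1 / 16) :
    |cellVolume r p.1 p.2 - cellVolume r 0 1| ≤ 8 * ‖p - square‖ := by
  obtain ⟨ha, hb⟩ := norm_prod_le_iff.1 (le_refl ‖p - square‖)
  set ε := ‖p - square‖ with hε
  have ha' : |p.1| ≤ ε := by simpa [square] using ha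
  have hb' : |p.2 - 1| ≤ ε := by simpa [square] using hb
  have hε0 : 0 ≤ ε := norm_nonneg _
  have hpos : 0 < p.2 := by linarith [(abs_le.1 hb').1]
  have h1 := centredSquare_subset_voronoi hp ha' hb'
  have h2 := centredSquare_subset_voronoi (a := 0) (b := 1) hp (by simpa using hε0)
    (by simpa using hε0)
  have hfin : volume (voronoi 0 1) ≠ ∞ := by
    rw [volume_voronoi 0 one_pos]
    exact ENNReal.one_ne_top
  have hvol := measureReal_mono (μ := volume) (subset_inter h1 h2)
    (measure_ne_top_of_subset inter_subset_right hfin)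
  rw [volume_centredSquare (by linarith)] at hvol
  have l1 := cellVolume_sub_le r p.1 0 (b' := 1) hpos
  have l2 := cellVolume_sub_le r 0 p.1 (b' := p.2) one_pos
  rw [inter_comm] at l2
  rw [abs_le]
  constructor <;> nlinarith

theorem cellVolume_eq_square {r : ℝ} (hr : r ≤ 1 / 4) {p : ℝ × ℝ} (hp : ‖p - square‖ ≤ 1 / 16) :
    cellVolume r p.1 p.2 = cellVolume r 0 1 := by
  obtain ⟨ha, hb⟩ := norm_prod_le_iff.1 hp
  have ha' : |p.1| ≤ 1 / 16 := by simpa [square] using ha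
  have hb' : |p.2 - 1| ≤ 1 / 16 := by simpa [square] using hb
  have key : ∀ a b : ℝ, |a| ≤ 1 / 16 → |b - 1| ≤ 1 / 16 → cellVolume r a b = discArea r := by
    intro a b ha hb
    rw [cellVolume, discArea, inter_eq_left.2]
    exact (ball_subset_centredSquare (by linarith)).trans
      (centredSquare_subset_voronoi le_rfl ha hb)
  rw [key _ _ ha' hb', key 0 1 (by norm_num) (by norm_num)]

/-! ### Radial integrals and the layer-cake formula -/

/-- The integral `∫ f(d²(x, 0)) dx` over `T_{a,b}`, computed on the Voronoi cell. -/
def radialIntegral (f : ℝ → ℝ) (a b : ℝ) : ℝ := ∫ x in voronoi a b, f (‖x‖ ^ 2)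

/-- The area of the superlevel set `{x | t < f(d²(x, 0))}` in `T_{a,b}`. -/
def levelVolume (f : ℝ → ℝ) (a b t : ℝ) : ℝ :=
  (volume.restrict (voronoi a b)).real {x | t < f (‖x‖ ^ 2)}

/-- Superlevel sets of a non-increasing function of the distance are balls, possibly empty or the
whole space. -/
theorem exists_level_radius {f : ℝ → ℝ} (hanti : AntitoneOn f (Ioi 0)) (t : ℝ) :
    (∃ r ≥ 0, (∀ s > 0, s < r → t < f (s ^ 2)) ∧ ∀ s > 0, t < f (s ^ 2) → s ≤ r) ∨
      ∀ s > 0, t < f (s ^ 2) := by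
  set S : Set ℝ := {s | 0 < s ∧ t < f (s ^ 2)} with hS
  have hdown : ∀ s > 0, ∀ s' ∈ S, s < s' → t < f (s ^ 2) := fun s hs s' hs' h =>
    hs'.2.trans_le (hanti (mem_Ioi.2 (pow_pos hs 2)) (mem_Ioi.2 (pow_pos hs'.1 2)) (by gcongr))
  by_cases hb : BddAbove S
  · refine Or.inl ⟨sSup S, Real.sSup_nonneg fun s hs => hs.1.le, fun s hs hlt => ?_,
      fun s hs hst => le_csSup hb ⟨hs, hst⟩⟩
    have hne : S.Nonempty := by
      by_contra h
      rw [not_nonempty_iff_eq_empty.1 h, Real.sSup_empty] at hlt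
      exact absurd hs hlt.not_gt
    obtain ⟨s', hs', h⟩ := exists_lt_of_lt_csSup hne hlt
    exact hdown s hs s' hs' h
  · refine Or.inr fun s hs => ?_
    obtain ⟨s', hs', h⟩ := not_bddAbove_iff.1 hb s
    exact hdown s hs s' hs' h

theorem levelVolume_eq_cellVolume {f : ℝ → ℝ} {t r : ℝ}
    (h1 : ∀ s > 0, s < r → t < f (s ^ 2)) (h2 : ∀ s > 0, t < f (s ^ 2) → s ≤ r) (a b : ℝ) :
    levelVolume f a b t = cellVolume r a b := by
  have h : volume.restrict (voronoi a b) {x | t < f (‖x‖ ^ 2)}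
      = volume.restrict (voronoi a b) (Metric.ball 0 r) := by
    refine measure_congr (ae_restrict_of_ae ?_)
    have e1 : volume (Metric.sphere (0 : Plane) r) = 0 := Measure.addHaar_sphere _ _ _
    have e2 : volume ({0} : Set Plane) = 0 := measure_singleton _
    filter_upwards [measure_eq_zero_iff_ae_notMem.1 e1, measure_eq_zero_iff_ae_notMem.1 e2]
      with x hx hx0
    have hx0' : 0 < ‖x‖ := norm_pos_iff.2 hx0
    rw [mem_sphere_zero_iff_norm] at hx
    refine propext ⟨fun h => ?_, fun h => ?_⟩
    · exact mem_ball_zero_iff.2 (lt_of_le_of_ne (h2 _ hx0' h) hx)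
    · exact h1 _ hx0' (mem_ball_zero_iff.1 h)
  rw [levelVolume, Measure.real, h, Measure.restrict_apply measurableSet_ball]
  rfl

theorem levelVolume_eq_one {f : ℝ → ℝ} {t : ℝ} (h : ∀ s > 0, t < f (s ^ 2)) (a : ℝ) {b : ℝ}
    (hb : 0 < b) : levelVolume f a b t = 1 := by
  have h : volume.restrict (voronoi a b) {x | t < f (‖x‖ ^ 2)}
      = volume.restrict (voronoi a b) univ := by
    refine measure_congr (ae_restrict_of_ae ?_)
    have e2 : volume ({0} : Set Plane) = 0 := measure_singleton _
    filter_upwards [measure_eq_zero_iff_ae_notMem.1 e2] with x hx0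
    exact propext ⟨fun _ => trivial, fun _ => h _ (norm_pos_iff.2 hx0)⟩
  rw [levelVolume, Measure.real, h, Measure.restrict_apply_univ, volume_voronoi a hb]
  rfl

theorem isFiniteMeasure_restrict_voronoi (a : ℝ) {b : ℝ} (hb : 0 < b) :
    IsFiniteMeasure (volume.restrict (voronoi a b)) :=
  ⟨by rw [Measure.restrict_apply_univ, volume_voronoi a hb]; exact ENNReal.one_lt_top⟩

theorem antitone_levelVolume (f : ℝ → ℝ) (a : ℝ) {b : ℝ} (hb : 0 < b) :
    Antitone (levelVolume f a b) := by
  have := isFiniteMeasure_restrict_voronoi a hb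
  exact fun s t hst => measureReal_mono fun x hx => lt_of_le_of_lt hst hx

theorem ae_nonneg_radial {f : ℝ → ℝ} (hpos : ∀ t ∈ Ioi (0 : ℝ), 0 < f t) (a b : ℝ) :
    0 ≤ᵐ[volume.restrict (voronoi a b)] fun x => f (‖x‖ ^ 2) := by
  refine ae_restrict_of_ae ?_
  have e2 : volume ({0} : Set Plane) = 0 := measure_singleton _
  filter_upwards [measure_eq_zero_iff_ae_notMem.1 e2] with x hx0
  exact (hpos _ (pow_pos (norm_pos_iff.2 hx0) 2)).le

theorem radialIntegral_eq_integral_levelVolume {f : ℝ → ℝ}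
    (hpos : ∀ t ∈ Ioi (0 : ℝ), 0 < f t) {a b : ℝ}
    (hint : IntegrableOn (fun x : Plane => f (‖x‖ ^ 2)) (voronoi a b)) :
    radialIntegral f a b = ∫ t in Ioi 0, levelVolume f a b t :=
  hint.integral_eq_integral_meas_lt (ae_nonneg_radial hpos a b)

theorem integrableOn_levelVolume {f : ℝ → ℝ} (hpos : ∀ t ∈ Ioi (0 : ℝ), 0 < f t) {a b : ℝ}
    (hint : IntegrableOn (fun x : Plane => f (‖x‖ ^ 2)) (voronoi a b)) :
    IntegrableOn (levelVolume f a b) (Ioi 0) := by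
  have hanti : Antitone fun t => volume.restrict (voronoi a b) {x | t < f (‖x‖ ^ 2)} :=
    fun s t hst => measure_mono fun x hx => lt_of_le_of_lt hst hx
  refine integrable_toReal_of_lintegral_ne_top hanti.measurable.aemeasurable ?_
  rw [← lintegral_eq_lintegral_meas_lt _ (ae_nonneg_radial hpos a b) hint.1.aemeasurable]
  exact hint.lintegral_lt_top.ne

theorem levelVolume_le {f : ℝ → ℝ} (hanti : AntitoneOn f (Ioi 0)) {a b a' b' : ℝ} (hb : 0 < b)
    (hb' : 0 < b') (h : ∀ r ≥ 0, cellVolume r a b ≤ cellVolume r a' b') (t : ℝ) :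
    levelVolume f a b t ≤ levelVolume f a' b' t := by
  rcases exists_level_radius hanti t with ⟨r, hr, h1, h2⟩ | h1
  · rw [levelVolume_eq_cellVolume h1 h2, levelVolume_eq_cellVolume h1 h2]
    exact h r hr
  · rw [levelVolume_eq_one h1 a hb, levelVolume_eq_one h1 a' hb']

/-- Larger balls give larger radial integrals. -/
theorem radialIntegral_le {f : ℝ → ℝ} (hpos : ∀ t ∈ Ioi (0 : ℝ), 0 < f t)
    (hanti : AntitoneOn f (Ioi 0))
    (hint : ∀ a b : ℝ, 0 < b → IntegrableOn (fun x : Plane => f (‖x‖ ^ 2)) (voronoi a b))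
    {a b a' b' : ℝ} (hb : 0 < b) (hb' : 0 < b')
    (h : ∀ r ≥ 0, cellVolume r a b ≤ cellVolume r a' b') :
    radialIntegral f a b ≤ radialIntegral f a' b' := by
  rw [radialIntegral_eq_integral_levelVolume hpos (hint a b hb),
    radialIntegral_eq_integral_levelVolume hpos (hint a' b' hb')]
  exact integral_mono (integrableOn_levelVolume hpos (hint a b hb))
    (integrableOn_levelVolume hpos (hint a' b' hb')) (levelVolume_le hanti hb hb' h)

/-- The comparison is strict if the balls are strictly larger for a range of radii. -/
theorem radialIntegral_lt {f : ℝ → ℝ} (hpos : ∀ t ∈ Ioi (0 : ℝ), 0 < f t)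
    (hanti : StrictAntiOn f (Ioi 0))
    (hint : ∀ a b : ℝ, 0 < b → IntegrableOn (fun x : Plane => f (‖x‖ ^ 2)) (voronoi a b))
    {a b a' b' r₁ r₂ : ℝ} (hb : 0 < b) (hb' : 0 < b')
    (h : ∀ r ≥ 0, cellVolume r a b ≤ cellVolume r a' b') (hr₁ : 0 < r₁) (hr : r₁ < r₂)
    (hlt : ∀ r ∈ Icc r₁ r₂, cellVolume r a b < cellVolume r a' b') :
    radialIntegral f a b < radialIntegral f a' b' := by
  rw [radialIntegral_eq_integral_levelVolume hpos (hint a b hb),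
    radialIntegral_eq_integral_levelVolume hpos (hint a' b' hb')]
  have hr₂ : 0 < r₂ := hr₁.trans hr
  have hi := integrableOn_levelVolume hpos (hint a b hb)
  have hi' := integrableOn_levelVolume hpos (hint a' b' hb')
  rw [← sub_pos, ← integral_sub hi' hi, integral_pos_iff_support_of_nonneg
    (fun t => sub_nonneg.2 (levelVolume_le hanti.antitoneOn hb hb' h t)) (hi'.sub hi)]
  have hf : f (r₂ ^ 2) < f (r₁ ^ 2) :=
    hanti (mem_Ioi.2 (pow_pos hr₁ 2)) (mem_Ioi.2 (pow_pos hr₂ 2)) (by gcongr)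
  have hsub : Ioo (f (r₂ ^ 2)) (f (r₁ ^ 2))
      ⊆ Function.support fun t => levelVolume f a' b' t - levelVolume f a b t := by
    rintro t ⟨ht2, ht1⟩
    rw [Function.mem_support, sub_ne_zero]
    refine ne_of_gt ?_
    rcases exists_level_radius hanti.antitoneOn t with ⟨r, hr0, h1, h2⟩ | h1
    · rw [levelVolume_eq_cellVolume h1 h2, levelVolume_eq_cellVolume h1 h2]
      refine hlt r ⟨h2 _ hr₁ ht1, ?_⟩
      by_contra hcon
      exact absurd (h1 _ hr₂ (not_le.1 hcon)) ht2.not_gt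
    · exact absurd (h1 _ hr₂) ht2.not_gt
  refine lt_of_lt_of_le ?_ (measure_mono hsub)
  rw [Measure.restrict_apply measurableSet_Ioo, inter_eq_left.2, Real.volume_Ioo]
  · exact ENNReal.ofReal_pos.2 (sub_pos.2 hf)
  · exact fun t ht => mem_Ioi.2 ((hpos _ (mem_Ioi.2 (pow_pos hr₂ 2))).trans ht.1)

theorem radialIntegral_le_equilateral {f : ℝ → ℝ} (hpos : ∀ t ∈ Ioi (0 : ℝ), 0 < f t)
    (hanti : AntitoneOn f (Ioi 0))
    (hint : ∀ a b : ℝ, 0 < b → IntegrableOn (fun x : Plane => f (‖x‖ ^ 2)) (voronoi a b))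
    {p : ℝ × ℝ} (hp : p ∈ parameterDomain) :
    radialIntegral f p.1 p.2 ≤ radialIntegral f equilateral.1 equilateral.2 :=
  radialIntegral_le hpos hanti hint hp.1 equilateral_mem.1
    fun _ hr => cellVolume_le_equilateral hr hp

theorem radialIntegral_lt_equilateral {f : ℝ → ℝ} (hpos : ∀ t ∈ Ioi (0 : ℝ), 0 < f t)
    (hanti : StrictAntiOn f (Ioi 0))
    (hint : ∀ a b : ℝ, 0 < b → IntegrableOn (fun x : Plane => f (‖x‖ ^ 2)) (voronoi a b))
    {p : ℝ × ℝ} (hp : p ∈ parameterDomain) (hne : p ≠ equilateral) :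
    radialIntegral f p.1 p.2 < radialIntegral f equilateral.1 equilateral.2 := by
  -- `0.56` and `0.6` lie between the inradius and the circumradius of the hexagonal cell
  refine radialIntegral_lt (r₁ := 0.56) (r₂ := 0.6) hpos hanti hint hp.1 equilateral_mem.1
    (fun _ hr => cellVolume_le_equilateral hr hp) (by norm_num) (by norm_num) fun r hr => ?_
  have h1 : (1.7 : ℝ) ≤ √3 := Real.le_sqrt_of_sq_le (by norm_num)
  have h2 : √3 ≤ 1.8 := Real.sqrt_le_iff.2 ⟨by norm_num, by norm_num⟩
  obtain ⟨hr1, hr2⟩ := hr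
  norm_num at h1 h2 hr1 hr2
  exact cellVolume_lt_equilateral (by linarith) (by nlinarith) (by nlinarith) hp hne

theorem radialIntegral_rectangular_lt {f : ℝ → ℝ} (hpos : ∀ t ∈ Ioi (0 : ℝ), 0 < f t)
    (hanti : StrictAntiOn f (Ioi 0))
    (hint : ∀ a b : ℝ, 0 < b → IntegrableOn (fun x : Plane => f (‖x‖ ^ 2)) (voronoi a b))
    {b : ℝ} (hb : 1 < b) : radialIntegral f 0 b < radialIntegral f 0 1 := by
  -- `0.6` and `0.7` lie between the inradius and the circumradius of the unit square
  refine radialIntegral_lt (r₁ := 0.6) (r₂ := 0.7) hpos hanti hint (one_pos.trans hb) one_pos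
    (fun _ hr => cellVolume_rectangular_le hr hb) (by norm_num) (by norm_num) fun r hr => ?_
  obtain ⟨hr1, hr2⟩ := hr
  norm_num at hr1 hr2
  exact cellVolume_rectangular_lt (by linarith) hb (by nlinarith) (by nlinarith)

theorem lt_radialIntegral_sheared {f : ℝ → ℝ} (hpos : ∀ t ∈ Ioi (0 : ℝ), 0 < f t)
    (hanti : StrictAntiOn f (Ioi 0))
    (hint : ∀ a b : ℝ, 0 < b → IntegrableOn (fun x : Plane => f (‖x‖ ^ 2)) (voronoi a b))
    {a : ℝ} (ha : 0 < a) (ha1 : a ≤ 1 / 2) : radialIntegral f 0 1 < radialIntegral f a 1 := by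
  refine radialIntegral_lt (r₁ := 0.52) (r₂ := 0.55) hpos hanti hint one_pos one_pos
    (fun r _ => cellVolume_zero_le r a one_pos) (by norm_num) (by norm_num) fun r hr => ?_
  obtain ⟨hr1, hr2⟩ := hr
  norm_num at hr1 hr2
  exact lt_cellVolume_sheared (by linarith) ha ha1 (by nlinarith) (by nlinarith)

/-- The square torus is a critical point of every radial integral: differentiate the layer-cake
formula under the integral sign. Levels `t ≥ f(1/16)` do not contribute, their superlevel sets being
contained in all cells. -/
theorem hasFDerivAt_radialIntegral {f : ℝ → ℝ} (hpos : ∀ t ∈ Ioi (0 : ℝ), 0 < f t)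
    (hanti : AntitoneOn f (Ioi 0))
    (hint : ∀ a b : ℝ, 0 < b → IntegrableOn (fun x : Plane => f (‖x‖ ^ 2)) (voronoi a b)) :
    HasFDerivAt (fun p : ℝ × ℝ => radialIntegral f p.1 p.2) (0 : ℝ × ℝ →L[ℝ] ℝ) square := by
  have hball : Metric.closedBall square (1 / 16) ∈ 𝓝 square :=
    Metric.closedBall_mem_nhds _ (by norm_num)
  have hpos2 : ∀ p ∈ Metric.closedBall square (1 / 16), 0 < p.2 := by
    intro p hp
    rw [mem_closedBall_iff_norm] at hp
    have := (norm_prod_le_iff.1 hp).2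
    have h : |p.2 - 1| ≤ 1 / 16 := by simpa [square] using this
    linarith [(abs_le.1 h).1]
  have hbound : IntegrableOn ((Iio (f (1 / 16))).indicator fun _ => (8 : ℝ)) (Ioi 0) := by
    rw [IntegrableOn, integrable_indicator_iff measurableSet_Iio, IntegrableOn,
      Measure.restrict_restrict measurableSet_Iio, Iio_inter_Ioi]
    exact integrableOn_const (by rw [Real.volume_Ioo]; exact ENNReal.ofReal_ne_top)
  set bound : ℝ → ℝ := (Iio (f (1 / 16))).indicator fun _ => 8 with hbd
  have hmeas : ∀ p ∈ Metric.closedBall square (1 / 16),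
      AEStronglyMeasurable (fun t => levelVolume f p.1 p.2 t) (volume.restrict (Ioi 0)) :=
    fun p hp => (antitone_levelVolume f p.1 (hpos2 p hp)).measurable.aestronglyMeasurable
  have hlip : ∀ᵐ t ∂volume.restrict (Ioi 0), ∀ p ∈ Metric.closedBall square (1 / 16),
      ‖levelVolume f p.1 p.2 t - levelVolume f square.1 square.2 t‖ ≤ bound t * ‖p - square‖ := by
    refine Eventually.of_forall fun t p hp => ?_
    have hp' := mem_closedBall_iff_norm.1 hp
    change |levelVolume f p.1 p.2 t - levelVolume f 0 1 t| ≤ _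
    rcases exists_level_radius hanti t with ⟨r, hr, h1, h2⟩ | h1
    · rw [levelVolume_eq_cellVolume h1 h2, levelVolume_eq_cellVolume h1 h2]
      by_cases ht : t < f (1 / 16)
      · rw [hbd, indicator_of_mem (mem_Iio.2 ht)]
        exact abs_cellVolume_sub_square_le r hp'
      · rw [hbd, indicator_of_notMem (by simpa using ht), zero_mul, cellVolume_eq_square _ hp',
          sub_self, abs_zero]
        by_contra hcon
        have := h1 (1 / 4) (by norm_num) (not_le.1 hcon)
        norm_num at this ht
        linarith
    · rw [levelVolume_eq_one h1 _ (hpos2 p hp), levelVolume_eq_one h1 _ one_pos, sub_self,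
        abs_zero]
      exact mul_nonneg (indicator_nonneg (fun _ _ => by norm_num) _) (norm_nonneg _)
  have hdiff : ∀ᵐ t ∂volume.restrict (Ioi 0), HasFDerivAt
      (fun p : ℝ × ℝ => levelVolume f p.1 p.2 t) (0 : ℝ × ℝ →L[ℝ] ℝ) square := by
    refine Eventually.of_forall fun t => ?_
    rcases exists_level_radius hanti t with ⟨r, hr, h1, h2⟩ | h1
    · simp only [levelVolume_eq_cellVolume h1 h2]
      exact hasFDerivAt_cellVolume hr
    · refine (hasFDerivAt_const (1 : ℝ) square).congr_of_eventuallyEq ?_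
      filter_upwards [hball] with p hp
      exact levelVolume_eq_one h1 _ (hpos2 p hp)
  have hint₀ : Integrable (fun t => levelVolume f square.1 square.2 t) (volume.restrict (Ioi 0)) :=
    integrableOn_levelVolume hpos (hint 0 1 one_pos)
  have hder := (hasFDerivAt_integral_of_dominated_loc_of_lip' (𝕜 := ℝ)
    (F := fun (p : ℝ × ℝ) t => levelVolume f p.1 p.2 t) (F' := fun _ => 0)
    hball hmeas hint₀ aestronglyMeasurable_const hlip hbound hdiff).2
  rw [integral_zero] at hder
  refine hder.congr_of_eventuallyEq ?_
  filter_upwards [hball] with p hp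
  exact radialIntegral_eq_integral_levelVolume hpos (hint _ _ (hpos2 p hp))

/-- A critical point at the square torus is a saddle point if sheared tori have larger and elongated
rectangular tori have smaller values. -/
theorem isSaddlePoint_square {N : ℝ × ℝ → ℝ} (hN : IsCriticalPoint N square)
    (h1 : ∀ a : ℝ, 0 < a → a ≤ 1 / 2 → N square < N (a, 1))
    (h2 : ∀ b : ℝ, 1 < b → N (0, b) < N square) : IsSaddlePoint N square := by
  refine ⟨hN, fun hmax => ?_, fun hmin => ?_⟩
  · have ht : Tendsto (fun a : ℝ => (a, (1 : ℝ))) (𝓝[>] 0) (𝓝[parameterDomain] square) := by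
      refine tendsto_nhdsWithin_iff.2 ⟨?_, ?_⟩
      · have : Continuous fun a : ℝ => (a, (1 : ℝ)) := by fun_prop
        exact (this.tendsto 0).mono_left nhdsWithin_le_nhds
      · filter_upwards [Ioo_mem_nhdsGT (by norm_num : (0 : ℝ) < 1 / 2)] with a ha
        exact ⟨one_pos, ⟨ha.1.le, ha.2.le⟩, by simp only; nlinarith [sq_nonneg a]⟩
    obtain ⟨a, ha, ha'⟩ := ((ht.eventually hmax).and
      (Ioo_mem_nhdsGT (by norm_num : (0 : ℝ) < 1 / 2))).exists
    exact absurd (h1 a ha'.1 ha'.2.le) (not_lt.2 ha)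
  · have ht : Tendsto (fun b : ℝ => ((0 : ℝ), b)) (𝓝[>] 1) (𝓝[parameterDomain] square) := by
      refine tendsto_nhdsWithin_iff.2 ⟨?_, ?_⟩
      · have : Continuous fun b : ℝ => ((0 : ℝ), b) := by fun_prop
        exact (this.tendsto 1).mono_left nhdsWithin_le_nhds
      · filter_upwards [self_mem_nhdsWithin] with b hb
        have hb' : (1 : ℝ) < b := hb
        exact ⟨one_pos.trans hb', ⟨le_rfl, by norm_num⟩, by simp only; nlinarith⟩
    obtain ⟨b, hb, hb'⟩ := ((ht.eventually hmin).and self_mem_nhdsWithin).exists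
    exact absurd (h2 b hb') (not_lt.2 hb)

/-! ### Norms of integral operators -/

/-- An orthonormal family in a separable space is countable, its members being at distance `√2`. -/
theorem countable_of_hilbertBasis {𝕜 H ι : Type*} [RCLike 𝕜] [NormedAddCommGroup H]
    [InnerProductSpace 𝕜 H] [SecondCountableTopology H] (b : HilbertBasis ι 𝕜 H) :
    Countable ι := by
  have hd : ∀ i j, i ≠ j → 2 ≤ dist (b i) (b j) ^ 2 := by
    intro i j hij
    rw [dist_eq_norm, norm_sub_sq (𝕜 := 𝕜), b.orthonormal.inner_eq_zero hij,
      b.orthonormal.norm_eq_one, b.orthonormal.norm_eq_one]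
    norm_num
  have hdisj : (univ : Set ι).PairwiseDisjoint fun i => Metric.ball (b i) (1 / 2) := by
    intro i _ j _ hij
    refine Metric.ball_disjoint_ball ?_
    have := hd i j hij
    have h0 : 0 ≤ dist (b i) (b j) := dist_nonneg
    nlinarith
  have := hdisj.countable_of_isOpen (fun i _ => Metric.isOpen_ball)
    fun i _ => ⟨b i, Metric.mem_ball_self (by norm_num)⟩
  exact countable_univ_iff.1 this

section IntegralOperatorNorms

variable {𝕜 X : Type*} [RCLike 𝕜] [MeasurableSpace X] {μ : Measure X}

theorem enorm_Lp_sq {ψ : X → 𝕜} (hψ : MemLp ψ 2 μ) :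
    ‖hψ.toLp ψ‖ₑ ^ 2 = ∫⁻ x, ‖ψ x‖ₑ ^ 2 ∂μ := by
  rw [Lp.enorm_toLp, eLpNorm_eq_lintegral_rpow_enorm_toReal (by norm_num) (by norm_num),
    ← ENNReal.rpow_natCast, ← ENNReal.rpow_mul]
  simp

/-- The Cauchy-Schwarz step of Schur's test. -/
theorem sq_lintegral_mul_le {k ψ : X → ℝ≥0∞} (hk : AEMeasurable k μ) (hψ : AEMeasurable ψ μ) :
    (∫⁻ y, k y * ψ y ∂μ) ^ 2 ≤ (∫⁻ y, k y ∂μ) * ∫⁻ y, k y * ψ y ^ 2 ∂μ := by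
  have h := ENNReal.lintegral_mul_le_Lp_mul_Lq μ Real.HolderConjugate.two_two
    (hk.pow_const (1 / 2 : ℝ)) ((hk.pow_const (1 / 2 : ℝ)).mul hψ)
  have e0 : ∀ z : ℝ≥0∞, z ^ (1 / 2 : ℝ) * z ^ (1 / 2 : ℝ) = z := fun z => by
    rw [← ENNReal.rpow_add_of_nonneg _ _ (by norm_num) (by norm_num)]
    norm_num
  have e1 : ∀ z : ℝ≥0∞, (z ^ (1 / 2 : ℝ)) ^ (2 : ℝ) = z := fun z => by
    rw [← ENNReal.rpow_mul]
    norm_num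
  have e2 : ∀ z : ℝ≥0∞, (z ^ (1 / 2 : ℝ)) ^ 2 = z := fun z => by rw [pow_two, e0]
  simp only [Pi.mul_apply, ENNReal.mul_rpow_of_nonneg _ _ (zero_le_two : (0 : ℝ) ≤ 2), e1,
    ← mul_assoc, e0] at h
  calc (∫⁻ y, k y * ψ y ∂μ) ^ 2
      ≤ ((∫⁻ y, k y ∂μ) ^ (1 / 2 : ℝ) * (∫⁻ y, k y * ψ y ^ (2 : ℝ) ∂μ) ^ (1 / 2 : ℝ)) ^ 2 := by
        gcongr
    _ = _ := by
        rw [mul_pow, e2, e2]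
        simp only [ENNReal.rpow_two]

variable [SFinite μ]

/-- Schur's test. -/
theorem norm_integralOperator_le {k : X → X → 𝕜}
    (hk : MemLp (fun p : X × X => k p.1 p.2) 2 (μ.prod μ)) {I : ℝ≥0∞} (hI : I ≠ ∞)
    (h1 : ∀ x, ∫⁻ y, ‖k x y‖ₑ ∂μ ≤ I) (h2 : ∀ y, ∫⁻ x, ‖k x y‖ₑ ∂μ ≤ I) :
    ‖integralOperator k hk‖ ≤ I.toReal := by
  refine ContinuousLinearMap.opNorm_le_bound _ ENNReal.toReal_nonneg fun ψ => ?_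
  have hψ := Lp.memLp ψ
  have hpt : ∀ᵐ x ∂μ, ‖∫ y, k x y * ψ y ∂μ‖ₑ ^ 2 ≤ I * ∫⁻ y, ‖k x y‖ₑ * ‖ψ y‖ₑ ^ 2 ∂μ := by
    filter_upwards [ae_memLp_section hk] with x hx
    have h3 : ‖∫ y, k x y * ψ y ∂μ‖ₑ ≤ ∫⁻ y, ‖k x y‖ₑ * ‖ψ y‖ₑ ∂μ := by
      refine (enorm_integral_le_lintegral_enorm _).trans (le_of_eq ?_)
      simp only [enorm_mul]
    calc ‖∫ y, k x y * ψ y ∂μ‖ₑ ^ 2 ≤ (∫⁻ y, ‖k x y‖ₑ * ‖ψ y‖ₑ ∂μ) ^ 2 := by gcongr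
      _ ≤ _ := sq_lintegral_mul_le hx.1.enorm hψ.1.enorm
      _ ≤ _ := by gcongr; exact h1 x
  have hm : AEMeasurable (fun p : X × X => ‖k p.1 p.2‖ₑ * ‖ψ p.2‖ₑ ^ 2) (μ.prod μ) :=
    hk.1.enorm.mul (hψ.1.comp_snd.enorm.pow_const 2)
  have hsq : ‖integralOperator k hk ψ‖ₑ ^ 2 ≤ (I * ‖ψ‖ₑ) ^ 2 := by
    have e1 : ‖integralOperator k hk ψ‖ₑ ^ 2 = ∫⁻ x, ‖∫ y, k x y * ψ y ∂μ‖ₑ ^ 2 ∂μ :=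
      enorm_Lp_sq (memLp_integral hk (Lp.memLp ψ))
    have e2 : ‖ψ‖ₑ ^ 2 = ∫⁻ x, ‖ψ x‖ₑ ^ 2 ∂μ := by
      have := enorm_Lp_sq hψ
      rwa [Lp.toLp_coeFn] at this
    rw [e1, mul_pow, e2]
    calc ∫⁻ x, ‖∫ y, k x y * ψ y ∂μ‖ₑ ^ 2 ∂μ
        ≤ ∫⁻ x, I * ∫⁻ y, ‖k x y‖ₑ * ‖ψ y‖ₑ ^ 2 ∂μ ∂μ := lintegral_mono_ae hpt
      _ = I * ∫⁻ y, ∫⁻ x, ‖k x y‖ₑ * ‖ψ y‖ₑ ^ 2 ∂μ ∂μ := by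
          rw [lintegral_const_mul' _ _ hI, lintegral_lintegral_swap hm]
      _ ≤ I * ∫⁻ y, I * ‖ψ y‖ₑ ^ 2 ∂μ := by
          gcongr with y
          rw [lintegral_mul_const' _ _ (ENNReal.pow_ne_top enorm_ne_top)]
          gcongr
          exact h2 y
      _ = I ^ 2 * ∫⁻ x, ‖ψ x‖ₑ ^ 2 ∂μ := by
          rw [lintegral_const_mul' _ _ hI, ← mul_assoc, pow_two]
  have h3 : ‖integralOperator k hk ψ‖ₑ ≤ I * ‖ψ‖ₑ := by
    have := ENNReal.pow_le_pow_left_iff (two_ne_zero) |>.1 hsq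
    exact this
  have h4 := ENNReal.toReal_mono (ENNReal.mul_ne_top hI enorm_ne_top) h3
  rwa [ENNReal.toReal_mul, toReal_enorm, toReal_enorm] at h4

/-- If all rows of the kernel have the same integral `c`, constants are eigenfunctions. -/
theorem le_norm_integralOperator [IsFiniteMeasure μ] [NeZero μ] {k : X → X → 𝕜}
    (hk : MemLp (fun p : X × X => k p.1 p.2) 2 (μ.prod μ)) {c : 𝕜}
    (h : ∀ x, ∫ y, k x y ∂μ = c) : ‖c‖ ≤ ‖integralOperator k hk‖ := by
  have h1 : MemLp (fun _ : X => (1 : 𝕜)) 2 μ := memLp_const 1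
  set e := h1.toLp with he
  have hA : integralOperator k hk e = c • e := by
    rw [he, ← MemLp.toLp_const_smul]
    refine MemLp.toLp_congr (memLp_integral hk (Lp.memLp _)) _ (Eventually.of_forall fun x => ?_)
    simp only [Pi.smul_apply, smul_eq_mul, mul_one]
    rw [← h x]
    refine integral_congr_ae ?_
    filter_upwards [h1.coeFn_toLp] with y hy
    rw [hy, mul_one]
  have hne : 0 < ‖e‖ := by
    rw [norm_pos_iff]
    intro h0
    have h2 := enorm_Lp_sq h1
    rw [← he, h0] at h2
    simp at h2
    exact NeZero.ne μ (Measure.measure_univ_eq_zero.1 h2.symm)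
  have h2 := (integralOperator k hk).le_opNorm e
  rw [hA, norm_smul] at h2
  exact le_of_mul_le_mul_right h2 hne

/-- The Hilbert-Schmidt norm of an integral operator is the `L²` norm of its kernel: Parseval's
identity in each row. -/
theorem ehsNorm_integralOperator [SecondCountableTopology (Lp 𝕜 2 μ)] {k : X → X → 𝕜}
    (hk : MemLp (fun p : X × X => k p.1 p.2) 2 (μ.prod μ)) :
    ehsNorm (integralOperator k hk) = (∫⁻ x, ∫⁻ y, ‖k x y‖ₑ ^ 2 ∂μ ∂μ) ^ (1 / 2 : ℝ) := by
  obtain ⟨w, b, -⟩ := exists_hilbertBasis 𝕜 (Lp 𝕜 2 μ)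
  have : Countable w := countable_of_hilbertBasis b
  rw [ehsNorm_eq b]
  congr 1
  have e1 : ∀ i, ‖integralOperator k hk (b i)‖ₑ ^ 2 = ∫⁻ x, ‖∫ y, k x y * b i y ∂μ‖ₑ ^ 2 ∂μ :=
    fun i => enorm_Lp_sq (memLp_integral hk (Lp.memLp (b i)))
  simp only [e1]
  rw [← lintegral_tsum fun i => (memLp_integral hk (Lp.memLp (b i))).1.enorm.pow_const 2]
  refine lintegral_congr_ae ?_
  filter_upwards [ae_memLp_section hk] with x hx
  have hx' : MemLp (fun y => star (k x y)) 2 μ := hx.star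
  have e2 : ∫⁻ y, ‖k x y‖ₑ ^ 2 ∂μ = ‖hx'.toLp‖ₑ ^ 2 := by
    rw [enorm_Lp_sq hx']
    refine lintegral_congr fun y => ?_
    rw [← ofReal_norm, ← ofReal_norm, norm_star]
  rw [e2, ← tsum_inner_sq b]
  refine tsum_congr fun i => ?_
  have e3 : ∫ y, k x y * b i y ∂μ = inner 𝕜 hx'.toLp (b i) := by
    rw [L2.inner_def]
    refine integral_congr_ae ?_
    filter_upwards [hx'.coeFn_toLp] with y hy
    rw [hy, RCLike.inner_apply, starRingEnd_apply, star_star, mul_comm]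
  rw [e3, ← ofReal_norm, ← ofReal_norm, norm_inner_symm]

end IntegralOperatorNorms

/-! ### The kernel `f(d²(x, y))` -/

/-- Only the values of `f` on `[0, ∞)` matter, and there `f` agrees with a measurable function. -/
theorem exists_measurable_eqOn {f : ℝ → ℝ} (hanti : AntitoneOn f (Ioi 0)) :
    ∃ g : ℝ → ℝ, Measurable g ∧ ∀ t, 0 ≤ t → g t = f t := by
  have h : Antitone fun s => f (Real.exp s) := fun s t hst =>
    hanti (mem_Ioi.2 (Real.exp_pos s)) (mem_Ioi.2 (Real.exp_pos t)) (Real.exp_le_exp.2 hst)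
  refine ⟨fun t => if t = 0 then f 0 else f (Real.exp (Real.log t)),
    Measurable.ite (measurableSet_singleton 0) measurable_const
      (h.measurable.comp Real.measurable_log), fun t ht => ?_⟩
  rcases ht.eq_or_lt with rfl | ht
  · simp
  · simp only [ht.ne', if_false, Real.exp_log ht]

theorem measurable_dist_torus (a : ℝ) {b : ℝ} (hb : 0 < b) :
    Measurable fun p : FlatTorus a b × FlatTorus a b => dist p.1 p.2 := by
  have : IsClosed (lattice a b : Set Plane) := isClosed_lattice a hb
  exact continuous_dist.measurable

/-- The area measure is invariant: a radial integral does not depend on the centre. -/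
theorem lintegral_dist_torusMeasure (a : ℝ) {b : ℝ} (hb : 0 < b) {φ : ℝ → ℝ≥0∞}
    (hφ : Measurable φ) (z : FlatTorus a b) :
    ∫⁻ y, φ (dist y z) ∂torusMeasure a b = ∫⁻ x in voronoi a b, φ ‖x‖ := by
  rw [← lintegral_norm_torusMeasure a hb hφ]
  simp only [dist_eq_norm]
  exact lintegral_torusMeasure_sub a hb z (hφ.comp (measurable_norm_torus a b))

theorem measurable_dist_right (a : ℝ) {b : ℝ} (hb : 0 < b) (z : FlatTorus a b) :
    Measurable fun y : FlatTorus a b => dist y z := by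
  have : IsClosed (lattice a b : Set Plane) := isClosed_lattice a hb
  have hc : Continuous fun y : FlatTorus a b => dist y z := continuous_id.dist continuous_const
  exact hc.measurable

theorem ae_dist_pos (a : ℝ) {b : ℝ} (hb : 0 < b) (z : FlatTorus a b) :
    ∀ᵐ y ∂torusMeasure a b, 0 < dist z y := by
  set φ : ℝ → ℝ≥0∞ := ({0} : Set ℝ).indicator 1 with hφd
  have hφ : Measurable φ := measurable_one.indicator (measurableSet_singleton 0)
  have h1 : ∀ s, s ≠ 0 → φ s = 0 := fun s hs => indicator_of_notMem (by simpa using hs) _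
  have h0 : φ 0 ≠ 0 := by simp [hφd]
  clear_value φ
  have hz : ∫⁻ x in voronoi a b, φ ‖x‖ = 0 := by
    refine lintegral_eq_zero_of_ae_eq_zero (ae_restrict_of_ae ?_)
    have e2 : volume ({0} : Set Plane) = 0 := measure_singleton _
    filter_upwards [measure_eq_zero_iff_ae_notMem.1 e2] with x hx
    exact h1 _ (norm_ne_zero_iff.2 hx)
  have hd : Measurable fun y : FlatTorus a b => φ (dist y z) :=
    hφ.comp (measurable_dist_right a hb z)
  have h : ∀ᵐ y ∂torusMeasure a b, φ (dist y z) = 0 :=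
    (lintegral_eq_zero_iff hd).1 ((lintegral_dist_torusMeasure a hb hφ z).trans hz)
  filter_upwards [h] with y hy
  rw [dist_comm]
  have hne : dist y z ≠ 0 := fun hyz => h0 (hyz ▸ hy)
  exact lt_of_le_of_ne dist_nonneg hne.symm

theorem lintegral_dist_torusMeasure' (a : ℝ) {b : ℝ} (hb : 0 < b) {φ : ℝ → ℝ≥0∞}
    (hφ : Measurable φ) (z : FlatTorus a b) :
    ∫⁻ y, φ (dist z y) ∂torusMeasure a b = ∫⁻ x in voronoi a b, φ ‖x‖ := by
  simp only [dist_comm z]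
  exact lintegral_dist_torusMeasure a hb hφ z

theorem lintegral_lintegral_dist (a : ℝ) {b : ℝ} (hb : 0 < b) {φ : ℝ → ℝ≥0∞}
    (hφ : Measurable φ) :
    ∫⁻ x, ∫⁻ y, φ (dist x y) ∂torusMeasure a b ∂torusMeasure a b
      = ∫⁻ x in voronoi a b, φ ‖x‖ := by
  simp only [lintegral_dist_torusMeasure' a hb hφ, lintegral_const, torusMeasure_univ a hb, mul_one]

theorem lintegral_kernel_sq {f : ℝ → ℝ} (hanti : AntitoneOn f (Ioi 0)) (a : ℝ) {b : ℝ}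
    (hb : 0 < b) :
    ∫⁻ x, ∫⁻ y, ‖kernel f a b x y‖ₑ ^ 2 ∂torusMeasure a b ∂torusMeasure a b
      = ∫⁻ x in voronoi a b, ‖f (‖x‖ ^ 2)‖ₑ ^ 2 := by
  obtain ⟨g, hg, hgf⟩ := exists_measurable_eqOn hanti
  have h := lintegral_lintegral_dist a hb (φ := fun s => ‖g (s ^ 2)‖ₑ ^ 2) (by fun_prop)
  simp only [hgf _ (sq_nonneg _)] at h
  exact h

/-- Every Voronoi cell contains a disc about the origin. -/
theorem exists_ball_subset_voronoi (a : ℝ) {b : ℝ} (hb : 0 < b) :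
    ∃ δ > 0, Metric.ball 0 δ ⊆ voronoi a b := by
  obtain ⟨δ, hδ, h⟩ := exists_le_norm_of_mem_lattice a hb
  refine ⟨δ / 2, by positivity, fun x hx v hv => ?_⟩
  rw [mem_ball_zero_iff] at hx
  by_cases hv0 : v = 0
  · simp [hv0]
  · have h1 := h v hv hv0
    have h2 := norm_sub_norm_le v x
    rw [norm_sub_rev] at h2
    linarith

/-- Square integrability only depends on the behaviour of `f` near `0`, hence not on the torus. -/
theorem lintegral_voronoi_lt_top {f : ℝ → ℝ} (hpos : ∀ t ∈ Ioi (0 : ℝ), 0 < f t)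
    (hanti : AntitoneOn f (Ioi 0)) {a b a' b' : ℝ} (hb : 0 < b) (hb' : 0 < b')
    (h : ∫⁻ x in voronoi a b, ‖f (‖x‖ ^ 2)‖ₑ ^ 2 < ∞) :
    ∫⁻ x in voronoi a' b', ‖f (‖x‖ ^ 2)‖ₑ ^ 2 < ∞ := by
  obtain ⟨δ, hδ, hsub⟩ := exists_ball_subset_voronoi a hb
  have hcover : voronoi a' b' ⊆ Metric.ball 0 δ ∪ (voronoi a' b' \ Metric.ball 0 δ) :=
    fun x hx => or_iff_not_imp_left.2 fun h => ⟨hx, h⟩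
  refine ((lintegral_mono_set hcover).trans (lintegral_union_le _ _ _)).trans_lt
    (ENNReal.add_lt_top.2 ⟨(lintegral_mono_set hsub).trans_lt h, ?_⟩)
  have hbound : ∫⁻ x in voronoi a' b' \ Metric.ball 0 δ, ‖f (‖x‖ ^ 2)‖ₑ ^ 2
      ≤ ∫⁻ _ in voronoi a' b' \ Metric.ball 0 δ, ‖f (δ ^ 2)‖ₑ ^ 2 := by
    refine setLIntegral_mono measurable_const fun x hx => ?_
    have hx' : δ ≤ ‖x‖ := by
      have := hx.2
      rwa [mem_ball_zero_iff, not_lt] at this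
    have hx0 : 0 < ‖x‖ := hδ.trans_le hx'
    have h1 := hanti (mem_Ioi.2 (pow_pos hδ 2)) (mem_Ioi.2 (pow_pos hx0 2)) (by gcongr)
    have h2 := hpos _ (mem_Ioi.2 (pow_pos hx0 2))
    gcongr
    rw [Real.enorm_of_nonneg h2.le, Real.enorm_of_nonneg (h2.le.trans h1)]
    exact ENNReal.ofReal_le_ofReal h1
  refine hbound.trans_lt ?_
  rw [setLIntegral_const]
  refine ENNReal.mul_lt_top (ENNReal.pow_lt_top enorm_lt_top)
    ((measure_mono sdiff_subset).trans_lt ?_)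
  rw [volume_voronoi a' hb']
  exact ENNReal.one_lt_top

theorem squareIntegrableKernel_iff {f : ℝ → ℝ} (hanti : AntitoneOn f (Ioi 0)) (a : ℝ) {b : ℝ}
    (hb : 0 < b) :
    SquareIntegrableKernel f a b ↔ ∫⁻ x in voronoi a b, ‖f (‖x‖ ^ 2)‖ₑ ^ 2 < ∞ := by
  rw [SquareIntegrableKernel, lintegral_kernel_sq hanti a hb]

theorem SquareIntegrableKernel.of_exists {f : ℝ → ℝ} (hpos : ∀ t ∈ Ioi (0 : ℝ), 0 < f t)
    (hanti : AntitoneOn f (Ioi 0))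
    (hf : ∃ p ∈ parameterDomain, SquareIntegrableKernel f p.1 p.2) (a : ℝ) {b : ℝ} (hb : 0 < b) :
    SquareIntegrableKernel f a b := by
  obtain ⟨p, hp, h⟩ := hf
  rw [squareIntegrableKernel_iff hanti p.1 hp.1] at h
  rw [squareIntegrableKernel_iff hanti a hb]
  exact lintegral_voronoi_lt_top hpos hanti hp.1 hb h

theorem memLp_radial {f : ℝ → ℝ} (hanti : AntitoneOn f (Ioi 0)) {a b : ℝ} (hb : 0 < b)
    (h : SquareIntegrableKernel f a b) :
    MemLp (fun x : Plane => f (‖x‖ ^ 2)) 2 (volume.restrict (voronoi a b)) := by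
  obtain ⟨g, hg, hgf⟩ := exists_measurable_eqOn hanti
  rw [squareIntegrableKernel_iff hanti a hb] at h
  have hm : Measurable fun x : Plane => f (‖x‖ ^ 2) := by
    simp only [← hgf _ (sq_nonneg _)]
    fun_prop
  refine ⟨hm.aestronglyMeasurable, ?_⟩
  rw [eLpNorm_lt_top_iff_lintegral_rpow_enorm_lt_top (by norm_num) (by norm_num)]
  simpa using h

theorem integrableOn_radial {f : ℝ → ℝ} (hanti : AntitoneOn f (Ioi 0)) {a b : ℝ} (hb : 0 < b)
    (h : SquareIntegrableKernel f a b) :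
    IntegrableOn (fun x : Plane => f (‖x‖ ^ 2)) (voronoi a b) := by
  have := isFiniteMeasure_restrict_voronoi a hb
  exact (memLp_radial hanti hb h).integrable (by norm_num)

theorem integrableOn_radial_sq {f : ℝ → ℝ} (hanti : AntitoneOn f (Ioi 0)) {a b : ℝ} (hb : 0 < b)
    (h : SquareIntegrableKernel f a b) :
    IntegrableOn (fun x : Plane => f (‖x‖ ^ 2) ^ 2) (voronoi a b) :=
  (memLp_radial hanti hb h).integrable_sq

theorem enorm_ofReal_eq (𝕜 : Type*) [RCLike 𝕜] (r : ℝ) : ‖(r : 𝕜)‖ₑ = ‖r‖ₑ := by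
  rw [← ofReal_norm, ← ofReal_norm, RCLike.norm_ofReal, Real.norm_eq_abs]

theorem memLp_kernel (𝕜 : Type*) [RCLike 𝕜] {f : ℝ → ℝ} (hanti : AntitoneOn f (Ioi 0))
    {a b : ℝ} (hb : 0 < b) (h : SquareIntegrableKernel f a b) :
    MemLp (fun p : FlatTorus a b × FlatTorus a b => ((kernel f a b p.1 p.2 : ℝ) : 𝕜)) 2
      ((torusMeasure a b).prod (torusMeasure a b)) := by
  obtain ⟨g, hg, hgf⟩ := exists_measurable_eqOn hanti
  have hm : Measurable fun p : FlatTorus a b × FlatTorus a b => kernel f a b p.1 p.2 := by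
    have h2 : (fun p : FlatTorus a b × FlatTorus a b => kernel f a b p.1 p.2)
        = fun p => g (dist p.1 p.2 ^ 2) := funext fun p => (hgf _ (sq_nonneg _)).symm
    rw [h2]
    exact hg.comp ((measurable_dist_torus a hb).pow_const 2)
  have hm' : Measurable fun p : FlatTorus a b × FlatTorus a b =>
      ((kernel f a b p.1 p.2 : ℝ) : 𝕜) := RCLike.measurable_ofReal.comp hm
  refine ⟨hm'.aestronglyMeasurable, ?_⟩
  rw [eLpNorm_lt_top_iff_lintegral_rpow_enorm_lt_top (by norm_num) (by norm_num),
    lintegral_prod _ (hm'.enorm.pow_const _).aemeasurable]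
  simpa [SquareIntegrableKernel, enorm_ofReal_eq] using h

theorem torusOperator_eq (𝕜 : Type*) [RCLike 𝕜] {f : ℝ → ℝ} {a b : ℝ}
    (hk : MemLp (fun p : FlatTorus a b × FlatTorus a b => ((kernel f a b p.1 p.2 : ℝ) : 𝕜)) 2
      ((torusMeasure a b).prod (torusMeasure a b))) :
    torusOperator 𝕜 f a b = integralOperator (fun x y => ((kernel f a b x y : ℝ) : 𝕜)) hk :=
  dif_pos hk

theorem ehsNorm_torusOperator (𝕜 : Type*) [RCLike 𝕜] {f : ℝ → ℝ} (hanti : AntitoneOn f (Ioi 0))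
    {a b : ℝ} (hb : 0 < b) (h : SquareIntegrableKernel f a b) :
    ehsNorm (torusOperator 𝕜 f a b)
      = (∫⁻ x in voronoi a b, ‖f (‖x‖ ^ 2)‖ₑ ^ 2) ^ (1 / 2 : ℝ) := by
  have : IsClosed (lattice a b : Set Plane) := isClosed_lattice a hb
  have : Fact ((2 : ℝ≥0∞) ≠ ∞) := ⟨ENNReal.ofNat_ne_top⟩
  rw [torusOperator_eq 𝕜 (memLp_kernel 𝕜 hanti hb h), ehsNorm_integralOperator,
    ← lintegral_kernel_sq hanti a hb]
  simp only [enorm_ofReal_eq]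

/-- `‖A_f‖_{H.S.}² = ∫ f(d²(x, 0))² dx`. -/
theorem hsNormFun_eq (𝕜 : Type*) [RCLike 𝕜] {f : ℝ → ℝ} (hanti : AntitoneOn f (Ioi 0))
    {p : ℝ × ℝ} (hb : 0 < p.2) (h : SquareIntegrableKernel f p.1 p.2) :
    hsNormFun 𝕜 f p = √(radialIntegral (fun t => f t ^ 2) p.1 p.2) := by
  rw [hsNormFun, hsNorm, ehsNorm_torusOperator 𝕜 hanti hb h, ← ENNReal.toReal_rpow,
    Real.sqrt_eq_rpow, radialIntegral,
    integral_eq_lintegral_of_nonneg_ae (Eventually.of_forall fun x => sq_nonneg _)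
      (integrableOn_radial_sq hanti hb h).1]
  congr 3
  funext x
  rw [← ofReal_norm, ← ENNReal.ofReal_pow (norm_nonneg _), Real.norm_eq_abs, sq_abs]

/-- `‖A_f‖ = ∫ f(d²(x, 0)) dx`: Schur's test gives one inequality, the constant functions the
other. -/
theorem opNormFun_eq (𝕜 : Type*) [RCLike 𝕜] {f : ℝ → ℝ} (hpos : ∀ t ∈ Ioi (0 : ℝ), 0 < f t)
    (hanti : AntitoneOn f (Ioi 0)) {p : ℝ × ℝ} (hb : 0 < p.2)
    (h : SquareIntegrableKernel f p.1 p.2) :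
    opNormFun 𝕜 f p = radialIntegral f p.1 p.2 := by
  obtain ⟨a, b⟩ := p
  simp only at hb h
  change ‖torusOperator 𝕜 f a b‖ = radialIntegral f a b
  obtain ⟨g, hg, hgf⟩ := exists_measurable_eqOn hanti
  have hint := integrableOn_radial hanti hb h
  have hpos' := ae_nonneg_radial hpos a b
  set I : ℝ≥0∞ := ∫⁻ x in voronoi a b, ‖f (‖x‖ ^ 2)‖ₑ with hI
  have hItop : I ≠ ∞ := hint.2.ne
  have hIreal : I.toReal = radialIntegral f a b := by
    rw [radialIntegral, integral_eq_lintegral_of_nonneg_ae hpos' hint.1]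
    congr 1
    refine lintegral_congr_ae ?_
    filter_upwards [hpos'] with x hx
    exact Real.enorm_of_nonneg hx
  have hφ : Measurable fun s : ℝ => ‖g (s ^ 2)‖ₑ := by fun_prop
  have h1 : ∀ x, ∫⁻ y, ‖((kernel f a b x y : ℝ) : 𝕜)‖ₑ ∂torusMeasure a b = I := by
    intro x
    simp only [enorm_ofReal_eq]
    have := lintegral_dist_torusMeasure' a hb hφ x
    simp only [hgf _ (sq_nonneg _)] at this
    exact this
  have h2 : ∀ y, ∫⁻ x, ‖((kernel f a b x y : ℝ) : 𝕜)‖ₑ ∂torusMeasure a b = I := by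
    intro y
    simp only [enorm_ofReal_eq]
    have := lintegral_dist_torusMeasure a hb hφ y
    simp only [hgf _ (sq_nonneg _)] at this
    exact this
  have h3 : ∀ x, ∫ y, ((kernel f a b x y : ℝ) : 𝕜) ∂torusMeasure a b
      = ((radialIntegral f a b : ℝ) : 𝕜) := by
    intro x
    have hd : Measurable fun y : FlatTorus a b => g (dist x y ^ 2) :=
      hg.comp (((measurable_dist_torus a hb).comp measurable_prodMk_left).pow_const 2)
    have hd' : (fun y : FlatTorus a b => kernel f a b x y) = fun y => g (dist x y ^ 2) :=
      funext fun y => (hgf _ (sq_nonneg _)).symm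
    have hae : 0 ≤ᵐ[torusMeasure a b] fun y => kernel f a b x y := by
      filter_upwards [ae_dist_pos a hb x] with y hy
      exact (hpos _ (mem_Ioi.2 (pow_pos hy 2))).le
    rw [integral_ofReal, integral_eq_lintegral_of_nonneg_ae hae (hd' ▸ hd.aestronglyMeasurable),
      ← hIreal, ← h1 x]
    congr 2
    refine lintegral_congr_ae ?_
    filter_upwards [hae] with y hy
    rw [enorm_ofReal_eq, Real.enorm_of_nonneg hy]
  have : IsFiniteMeasure (torusMeasure a b) :=
    ⟨by rw [torusMeasure_univ a hb]; exact ENNReal.one_lt_top⟩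
  have : NeZero (torusMeasure a b) := ⟨fun h0 => by
    have := torusMeasure_univ a hb
    simp [h0] at this⟩
  rw [torusOperator_eq 𝕜 (memLp_kernel 𝕜 hanti hb h)]
  refine le_antisymm ?_ ?_
  · rw [← hIreal]
    exact norm_integralOperator_le _ hItop (fun x => (h1 x).le) fun y => (h2 y).le
  · refine le_trans ?_ (le_norm_integralOperator _ h3)
    rw [RCLike.norm_ofReal]
    exact le_abs_self _

theorem radialIntegral_pos {f : ℝ → ℝ} (hpos : ∀ t ∈ Ioi (0 : ℝ), 0 < f t) (a : ℝ) {b : ℝ}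
    (hb : 0 < b) (hint : IntegrableOn (fun x : Plane => f (‖x‖ ^ 2)) (voronoi a b)) :
    0 < radialIntegral f a b := by
  rw [radialIntegral, integral_pos_iff_support_of_nonneg_ae (ae_nonneg_radial hpos a b) hint]
  have h : volume.restrict (voronoi a b) (Function.support fun x : Plane => f (‖x‖ ^ 2))
      = volume.restrict (voronoi a b) univ := by
    refine measure_congr (ae_restrict_of_ae ?_)
    have e2 : volume ({0} : Set Plane) = 0 := measure_singleton _
    filter_upwards [measure_eq_zero_iff_ae_notMem.1 e2] with x hx0
    exact propext ⟨fun _ => trivial,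
      fun _ => (hpos _ (mem_Ioi.2 (pow_pos (norm_pos_iff.2 hx0) 2))).ne'⟩
  rw [h, Measure.restrict_apply_univ, volume_voronoi a hb]
  exact one_pos

end FlatTori

end

theorem theorem1 (𝕜 : Type*) [RCLike 𝕜] (f : ℝ → ℝ)
    (hpos : ∀ t ∈ Ioi (0 : ℝ), 0 < f t)
    (hanti : AntitoneOn f (Ioi (0 : ℝ)))
    (hf : ∃ p ∈ FlatTori.parameterDomain, FlatTori.SquareIntegrableKernel f p.1 p.2) :
    -- on every torus the operator is given by the integral formula and is Hilbert-Schmidt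
    (∀ a b : ℝ, 0 < b →
      FlatTori.SquareIntegrableKernel f a b ∧
      (∀ ψ : Lp 𝕜 2 (FlatTori.torusMeasure a b),
        FlatTori.torusOperator 𝕜 f a b ψ =ᵐ[FlatTori.torusMeasure a b]
          fun x => ∫ y, ((f (dist x y ^ 2) : ℝ) : 𝕜) * ψ y ∂(FlatTori.torusMeasure a b)) ∧
      FlatTori.ehsNorm (FlatTori.torusOperator 𝕜 f a b) ≠ ∞) ∧
    -- the equilateral torus is a maximizer
    IsMaxOn (FlatTori.opNormFun 𝕜 f) FlatTori.parameterDomain FlatTori.equilateral ∧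
    IsMaxOn (FlatTori.hsNormFun 𝕜 f) FlatTori.parameterDomain FlatTori.equilateral ∧
    -- the square torus is a critical point
    FlatTori.IsCriticalPoint (FlatTori.opNormFun 𝕜 f) FlatTori.square ∧
    FlatTori.IsCriticalPoint (FlatTori.hsNormFun 𝕜 f) FlatTori.square ∧
    -- the strictly decreasing case
    (StrictAntiOn f (Ioi (0 : ℝ)) →
      (∀ p ∈ FlatTori.parameterDomain, p ≠ FlatTori.equilateral →
        FlatTori.opNormFun 𝕜 f p < FlatTori.opNormFun 𝕜 f FlatTori.equilateral) ∧
      (∀ p ∈ FlatTori.parameterDomain, p ≠ FlatTori.equilateral →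
        FlatTori.hsNormFun 𝕜 f p < FlatTori.hsNormFun 𝕜 f FlatTori.equilateral) ∧
      FlatTori.IsSaddlePoint (FlatTori.opNormFun 𝕜 f) FlatTori.square ∧
      FlatTori.IsSaddlePoint (FlatTori.hsNormFun 𝕜 f) FlatTori.square) := by
  open FlatTori in
  have hsi : ∀ (a : ℝ) {b : ℝ}, 0 < b → SquareIntegrableKernel f a b :=
    fun a b hb => SquareIntegrableKernel.of_exists hpos hanti hf a hb
  have hint : ∀ a b : ℝ, 0 < b → IntegrableOn (fun x : Plane => f (‖x‖ ^ 2)) (voronoi a b) :=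
    fun a b hb => integrableOn_radial hanti hb (hsi a hb)
  -- the Hilbert-Schmidt norm is treated as the operator norm of the squared kernel
  have hint2 : ∀ a b : ℝ, 0 < b →
      IntegrableOn (fun x : Plane => (fun t => f t ^ 2) (‖x‖ ^ 2)) (voronoi a b) :=
    fun a b hb => integrableOn_radial_sq hanti hb (hsi a hb)
  have hpos2 : ∀ t ∈ Ioi (0 : ℝ), 0 < f t ^ 2 := fun t ht => pow_pos (hpos t ht) 2
  have hanti2 : AntitoneOn (fun t => f t ^ 2) (Ioi (0 : ℝ)) := fun s hs t ht hst =>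
    pow_le_pow_left₀ (hpos t ht).le (hanti hs ht hst) 2
  have hop : ∀ p : ℝ × ℝ, 0 < p.2 → opNormFun 𝕜 f p = radialIntegral f p.1 p.2 :=
    fun p hp => opNormFun_eq 𝕜 hpos hanti hp (hsi p.1 hp)
  have hhs : ∀ p : ℝ × ℝ, 0 < p.2 →
      hsNormFun 𝕜 f p = √(radialIntegral (fun t => f t ^ 2) p.1 p.2) :=
    fun p hp => hsNormFun_eq 𝕜 hanti hp (hsi p.1 hp)
  have heq : 0 < equilateral.2 := equilateral_mem.1
  have hsq : 0 < square.2 := one_pos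
  have hnhds : ∀ᶠ p in 𝓝 square, 0 < p.2 :=
    (isOpen_lt continuous_const continuous_snd).mem_nhds hsq
  have hcrit : IsCriticalPoint (opNormFun 𝕜 f) square := by
    refine (hasFDerivAt_radialIntegral hpos hanti hint).congr_of_eventuallyEq ?_
    filter_upwards [hnhds] with p hp using hop p hp
  have hcrit2 : IsCriticalPoint (hsNormFun 𝕜 f) square := by
    have h := (hasFDerivAt_radialIntegral hpos2 hanti2 hint2).sqrt
      (radialIntegral_pos hpos2 0 one_pos (hint2 0 1 one_pos)).ne'
    rw [smul_zero] at h
    refine h.congr_of_eventuallyEq ?_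
    filter_upwards [hnhds] with p hp using hhs p hp
  refine ⟨fun a b hb => ⟨hsi a hb, fun ψ => ?_, ?_⟩, fun p hp => ?_, fun p hp => ?_, hcrit, hcrit2,
    fun hstrict => ?_⟩
  · rw [torusOperator_eq 𝕜 (memLp_kernel 𝕜 hanti hb (hsi a hb))]
    exact integralOperator_ae_eq _ _ ψ
  · rw [ehsNorm_torusOperator 𝕜 hanti hb (hsi a hb)]
    exact ENNReal.rpow_ne_top_of_nonneg (by norm_num)
      ((squareIntegrableKernel_iff hanti a hb).1 (hsi a hb)).ne
  · change opNormFun 𝕜 f p ≤ opNormFun 𝕜 f equilateral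
    rw [hop p hp.1, hop _ heq]
    exact radialIntegral_le_equilateral hpos hanti hint hp
  · change hsNormFun 𝕜 f p ≤ hsNormFun 𝕜 f equilateral
    rw [hhs p hp.1, hhs _ heq]
    exact Real.sqrt_le_sqrt (radialIntegral_le_equilateral hpos2 hanti2 hint2 hp)
  · have hstrict2 : StrictAntiOn (fun t => f t ^ 2) (Ioi (0 : ℝ)) := fun s hs t ht hst =>
      pow_lt_pow_left₀ (hstrict hs ht hst) (hpos t ht).le two_ne_zero
    have hlt : ∀ p q : ℝ × ℝ, 0 < p.2 → 0 < q.2 →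
        radialIntegral (fun t => f t ^ 2) p.1 p.2 < radialIntegral (fun t => f t ^ 2) q.1 q.2 →
        hsNormFun 𝕜 f p < hsNormFun 𝕜 f q := by
      intro p q hp hq h
      rw [hhs p hp, hhs q hq]
      exact Real.sqrt_lt_sqrt (radialIntegral_pos hpos2 _ hp (hint2 _ _ hp)).le h
    refine ⟨fun p hp hne => ?_, fun p hp hne => ?_, isSaddlePoint_square hcrit ?_ ?_,
      isSaddlePoint_square hcrit2 ?_ ?_⟩
    · rw [hop p hp.1, hop _ heq]
      exact radialIntegral_lt_equilateral hpos hstrict hint hp hne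
    · exact hlt _ _ hp.1 heq (radialIntegral_lt_equilateral hpos2 hstrict2 hint2 hp hne)
    · intro a ha ha1
      rw [hop _ hsq, hop (a, 1) one_pos]
      exact lt_radialIntegral_sheared hpos hstrict hint ha ha1
    · intro b hb
      rw [hop _ hsq, hop (0, b) (one_pos.trans hb)]
      exact radialIntegral_rectangular_lt hpos hstrict hint hb
    · exact fun a ha ha1 => hlt _ _ hsq one_pos
        (lt_radialIntegral_sheared hpos2 hstrict2 hint2 ha ha1)
    · exact fun b hb => hlt _ _ (one_pos.trans hb) hsq
        (radialIntegral_rectangular_lt hpos2 hstrict2 hint2 hb)
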